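/- Let $(\mathbf x,\mathbf y)$ have an arbitrary law $\mathbf D$ on a product $\mathcal X\times\mathcal Y$ of measurable spaces (for instance $\mathcal X,\mathcal Y\subseteq\mathbb R^N$), let $m\ge 1$, and let $\mathbf S=((\mathbf x_i,\mathbf y_i))_{i\le m}$ be an i.i.d. sample from $\mathbf D$. Let $\mathcal F_1$ and $\mathcal F_2$ be uniformly bounded classes of measurable real functions on $\mathcal X$ and $\mathcal Y$, each having a countable subclass such that every member of the class is a pointwise limit of a sequence from it. Put $$\mathcal R_m(\mathcal F_1)=\mathbb E_{\mathbf S}\,\mathbb E_\sigma\sup_{f\in\mathcal F_1}\frac1m\sum_{i=1}^m\sigma_i f(\mathbf x_i),\qquad \mathcal R_m(\mathcal F_2)=\mathbb E_{\mathbf S}\,\mathbb E_\sigma\sup_{f\in\mathcal F_2}\frac1m\sum_{i=1}^m\sigma_i f(\mathbf y_i),$$ with independent uniform signs $\sigma_i\in\{-1,1\}$. For $k=1,2$ let $D^{(k)}\in\mathbb N$ and $A^{(k)},\vartheta^{(k)}\in\mathbb R$. Let $\mathcal W_k\subseteq\mathbb R^{D^{(k)}}$ be a set of weight vectors, and let $\|\mathbf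 w^{(k)}\|_\infty$ denote a common bound on the sup norms of its elements (the sup norm of $\mathbf w^{(k)}$ itself if $\mathcal W_k=\{\mathbf w^{(k)}\}$). Assume that $\mathcal W_k$ has at most one element (fixed weights) or that $0\in\mathcal F_k$. Let $\mathcal G_k$ be a random collection of feature maps $\Phi^{(k)}=(\phi^{(k)}_1,\dots,\phi^{(k)}_{D^{(k)}})$ with $\phi^{(k)}_i\in\mathcal F_k$, $\phi^{(k)}_i\ge 0$ and $\|\Phi^{(k)}(\cdot)\|_2\le A^{(k)}$ everywhere, where $\mathcal G_1$, $\mathcal G_2$ and $\mathbf S$ are independent. A feature map $\Phi$ is called $\vartheta$-diverse if $\frac12\sum_{i\ne j}(\phi_i(\mathbf u)-\phi_j(\mathbf u))^2\ge\vartheta^2$ for every input $\mathbf u$. Assume that, for $k=1,2$, with probability at least $\tau_k\in[0,1]$ all feature maps in $\mathcal G_k$ are $\vartheta^{(k)}$-diverse. Let $\mathcal H$ be the set of pairs $h=(G^{(1)},G^{(2)})$ with $G^{(1)}(\mathbf x)=\sum_i w^{(1)}_i\phi^{(1)}_i(\mathbf x)$ and $G^{(2)}(\mathbf y)=\sum_i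 w^{(2)}_i\phi^{(2)}_i(\mathbf y)$, where $\mathbf w^{(k)}\in\mathcal W_k$ and $\Phi^{(k)}\in\mathcal G_k$. Let $E(h,\mathbf x,\mathbf y)=\frac12\|G^{(1)}(\mathbf x)-G^{(2)}(\mathbf y)\|_2^2$ and $\Delta_{\mathbf D,\mathbf S}E=\mathbb E_{(\mathbf x,\mathbf y)\sim\mathbf D}[E(h,\mathbf x,\mathbf y)]-\frac1m\sum_{i=1}^m E(h,\mathbf x_i,\mathbf y_i)$. Then for every $\delta\in(0,1)$, with probability at least $(1-\delta)\tau_1\tau_2$ the following holds for all $h\in\mathcal H$: $$\Delta_{\mathbf D,\mathbf S}E\le 8\big(\sqrt{\mathcal J_1}+\sqrt{\mathcal J_2}\big)\Big(D^{(1)}\|\mathbf w^{(1)}\|_\infty\mathcal R_m(\mathcal F_1)+D^{(2)}\|\mathbf w^{(2)}\|_\infty\mathcal R_m(\mathcal F_2)\Big)+(\mathcal J_1+\mathcal J_2)\sqrt{\frac{\log(2/\delta)}{2m}},$$ where $\mathcal J_k=\|\mathbf w^{(k)}\|_\infty^2\big(D^{(k)}(A^{(k)})^2-(\vartheta^{(k)})^2\big)$.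 -/

import Mathlib

open MeasureTheory Filter Topology

noncomputable section

/-- The event `E` has probability at least `p`: it contains a measurable event of probability at
least `p` (for a measurable `E` this is just `p ≤ P E`). -/
def WithProbAtLeast {Ω : Type*} [MeasurableSpace Ω] (P : Measure Ω) (p : ℝ) (E : Set Ω) : Prop :=
  ∃ T : Set Ω, MeasurableSet T ∧ T ⊆ E ∧ ENNReal.ofReal p ≤ P T

/-- The empirical Rademacher complexity of a class of real functions at the points `s 0, …`:
the average over all sign vectors of `sup_{f ∈ F} (1/m) ∑ σᵢ f(sᵢ)`. -/
def empiricalRademacher {α : Type*} {m : ℕ} (F : Set (α → ℝ)) (s : Fin m → α) : ℝ :=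
  (1 / 2 ^ m : ℝ) * ∑ σ : Fin m → ℤˣ,
    sSup ((fun f : α → ℝ => (1 / m : ℝ) * ∑ i, (((σ i : ℤˣ) : ℤ) : ℝ) * f (s i)) '' F)

/-- The Rademacher complexity `R_m(F)`: the expectation of the empirical one over a sample of `m`
independent data points with law `μ`, the functions of `F` being evaluated at the component
`proj z` of a data point `z`. -/
def rademacherComplexity {Z α : Type*} [MeasurableSpace Z] (μ : Measure Z) (m : ℕ)
    (proj : Z → α) (F : Set (α → ℝ)) : ℝ :=
  ∫ S : Fin m → Z, empiricalRademacher F (fun i => proj (S i)) ∂(Measure.pi fun _ => μ)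

/-- Regularity of a class of real functions that makes the suprema above meaningful: its members
are measurable and uniformly bounded, and a countable subclass is sequentially dense in it for
pointwise convergence. -/
structure IsRegularClass {α : Type*} [MeasurableSpace α] (F : Set (α → ℝ)) : Prop where
  measurable : ∀ f ∈ F, Measurable f
  bounded : ∃ C : ℝ, ∀ f ∈ F, ∀ x, |f x| ≤ C
  separable : ∃ F₀ : Set (α → ℝ), F₀ ⊆ F ∧ F₀.Countable ∧
    ∀ f ∈ F, ∃ u : ℕ → α → ℝ, (∀ n, u n ∈ F₀) ∧ ∀ x, Tendsto (fun n => u n x) atTop (𝓝 (f x))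

/-- The feature maps `Φ = (φ₁, …, φ_D)` whose components are non-negative functions of the
class `F` and which satisfy `‖Φ(x)‖₂ ≤ A` for every input. -/
def admissibleFeatures {α : Type*} (D : ℕ) (F : Set (α → ℝ)) (A : ℝ) :
    Set (α → EuclideanSpace ℝ (Fin D)) :=
  {Φ | (∀ i, (fun x => Φ x i) ∈ F) ∧ (∀ x i, 0 ≤ Φ x i) ∧ ∀ x, ‖Φ x‖ ≤ A}

/-- The feature set `Φ` is `ϑ`-diverse: `½ ∑_{i ≠ j} (φᵢ(x) - φⱼ(x))² ≥ ϑ²` for every input. -/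
def IsDiverse {α : Type*} {D : ℕ} (ϑ : ℝ) (Φ : α → EuclideanSpace ℝ (Fin D)) : Prop :=
  ∀ x, ϑ ^ 2 ≤ (1 / 2 : ℝ) *
    ∑ p ∈ (Finset.univ : Finset (Fin D)).offDiag, (Φ x p.1 - Φ x p.2) ^ 2

/-- The inner model `G(x) = ∑ wᵢ φᵢ(x)`. -/
def innerModel {α : Type*} {D : ℕ} (w : Fin D → ℝ) (Φ : α → EuclideanSpace ℝ (Fin D))
    (x : α) : ℝ :=
  ∑ i, w i * Φ x i

/-- All inner models with a weight vector in `W` and a feature map in `G`. -/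
def innerModels {α : Type*} {D : ℕ} (W : Set (Fin D → ℝ))
    (G : Set (α → EuclideanSpace ℝ (Fin D))) : Set (α → ℝ) :=
  {h | ∃ w ∈ W, ∃ Φ ∈ G, h = innerModel w Φ}

/-- The energy `½ ‖h₁(x) - h₂(y)‖²` of implicit regression. -/
def implicitEnergy {X Y : Type*} (h₁ : X → ℝ) (h₂ : Y → ℝ) (z : X × Y) : ℝ :=
  (1 / 2 : ℝ) * ‖h₁ z.1 - h₂ z.2‖ ^ 2

/-- The generalization gap: expected energy minus the average energy over the sample. -/
def generalizationGap {Z : Type*} [MeasurableSpace Z] (μ : Measure Z) {m : ℕ} (S : Fin m → Z)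
    (E : Z → ℝ) : ℝ :=
  (∫ z, E z ∂μ) - (1 / m : ℝ) * ∑ i, E (S i)

/-- `𝒥 = β² (D A² - ϑ²)`. -/
def diversityFactor (β : ℝ) (D : ℕ) (A ϑ : ℝ) : ℝ :=
  β ^ 2 * (D * A ^ 2 - ϑ ^ 2)

end

/-! Diversity improves the range of a model. Since `(∑ φᵢ)² = D ∑ φᵢ² - ½ ∑_{i≠j} (φᵢ - φⱼ)²`, a
model `G` with non-negative `ϑ`-diverse features satisfies `G² ≤ 𝒥`
(`innerModel_sq_le_diversityFactor`). The energy therefore lies in `[0, 𝒥₁ + 𝒥₂]` and is `(√𝒥₁ +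
√𝒥₂)`-Lipschitz in `G₁ - G₂`.

For a finite family the rest is the classical argument: bounded differences
(`measureReal_ge_le_of_bounded_differences`), symmetrization (`integral_iSup_generalizationGap_le`),
contraction (`signAverage_le_of_contraction`), and the complexity of linear combinations
(`signAverage_sum_mul_le`). This yields the constants `4` and `log (1 / δ)`; the stated `8` and `log
(2 / δ)` leave room.

The full class is reached through countably many approximants, with weights and features taken from
countable dense subsets. Approximants need not be diverse, so their models are truncated at `±√𝒥`.
Truncation is 1-Lipschitz, hence harmless under contraction, and inactive in the limit. The
resulting sample event serves all diverse admissible feature maps at once, so it does not depend on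
the random collections and the probabilities multiply. -/

noncomputable section

/-! ### Sign averages and the contraction principle. -/

/-- The average over all sign vectors `σ` of `sup_i ∑ⱼ σⱼ ℓ i j`. -/
def signAverage {ι : Type*} {m : ℕ} (ℓ : ι → Fin m → ℝ) : ℝ :=
  (1 / 2 ^ m : ℝ) * ∑ σ : Fin m → ℤˣ, ⨆ i, ∑ j, (((σ j : ℤˣ) : ℤ) : ℝ) * ℓ i j

/-- This is contraction for a single sign, whose two values contribute the two suprema. -/
lemma iSup_add_add_iSup_sub_le {ι : Type*} [Finite ι] [Nonempty ι] (b u v : ι → ℝ)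
    (h : ∀ i i', |u i - u i'| ≤ |v i - v i'|) :
    (⨆ i, (b i + u i)) + (⨆ i, (b i - u i)) ≤ (⨆ i, (b i + v i)) + ⨆ i, (b i - v i) := by
  rw [← le_sub_iff_add_le]
  refine ciSup_le fun i => ?_
  rw [le_sub_iff_add_le, ← le_sub_iff_add_le']
  refine ciSup_le fun i' => ?_
  rw [le_sub_iff_add_le']
  have h1 := Finite.le_ciSup (fun i => b i + v i) i
  have h2 := Finite.le_ciSup (fun i => b i - v i) i
  have h3 := Finite.le_ciSup (fun i => b i + v i) i'
  have h4 := Finite.le_ciSup (fun i => b i - v i) i'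
  have h5 := (le_abs_self _).trans (h i i')
  -- The indices `i`, `i'` can be placed in the two right-hand suprema in either order; the sign of
  -- `v i - v i'` selects the order that gains `|v i - v i'|`.
  rcases abs_cases (v i - v i') with h6 | h6 <;> linarith

lemma sum_signs_succ {m : ℕ} (f : (Fin (m + 1) → ℤˣ) → ℝ) :
    ∑ σ, f σ = ∑ τ : Fin m → ℤˣ, (f (Fin.cons 1 τ) + f (Fin.cons (-1) τ)) := by
  rw [← (Fin.consEquiv fun _ : Fin (m + 1) => ℤˣ).sum_comp, Fintype.sum_prod_type_right]
  refine Finset.sum_congr rfl fun τ _ => ?_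
  rw [show (Finset.univ : Finset ℤˣ) = {1, -1} from rfl,
    Finset.sum_pair (by decide)]
  rfl

/-- The contraction principle with an offset, before normalisation. -/
lemma sum_signs_iSup_le_of_contraction {ι : Type*} [Finite ι] [Nonempty ι] {m : ℕ}
    (a : ι → ℝ) (u v : ι → Fin m → ℝ) (h : ∀ j i i', |u i j - u i' j| ≤ |v i j - v i' j|) :
    ∑ σ : Fin m → ℤˣ, ⨆ i, (a i + ∑ j, (((σ j : ℤˣ) : ℤ) : ℝ) * u i j) ≤
      ∑ σ : Fin m → ℤˣ, ⨆ i, (a i + ∑ j, (((σ j : ℤˣ) : ℤ) : ℝ) * v i j) := by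
  induction m generalizing a with
  | zero => simp
  | succ m ih =>
    simp only [sum_signs_succ, Fin.sum_univ_succ, Fin.cons_zero, Fin.cons_succ]
    have e1 : ∀ τ : Fin m → ℤˣ,
        (⨆ i, (a i + ((((1 : ℤˣ) : ℤ) : ℝ) * u i 0 +
            ∑ j : Fin m, (((τ j : ℤˣ) : ℤ) : ℝ) * u i j.succ))) +
          (⨆ i, (a i + ((((-1 : ℤˣ) : ℤ) : ℝ) * u i 0 +
            ∑ j : Fin m, (((τ j : ℤˣ) : ℤ) : ℝ) * u i j.succ))) ≤
        (⨆ i, ((a i + v i 0) + ∑ j : Fin m, (((τ j : ℤˣ) : ℤ) : ℝ) * u i j.succ)) +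
          (⨆ i, ((a i - v i 0) + ∑ j : Fin m, (((τ j : ℤˣ) : ℤ) : ℝ) * u i j.succ)) := by
      intro τ
      have := iSup_add_add_iSup_sub_le
        (fun i => a i + ∑ j : Fin m, (((τ j : ℤˣ) : ℤ) : ℝ) * u i j.succ)
        (fun i => u i 0) (fun i => v i 0) (h 0)
      convert this using 4 <;> (try push_cast) <;> ring
    refine (Finset.sum_le_sum fun τ _ => e1 τ).trans ?_
    rw [Finset.sum_add_distrib]
    -- The coordinate already exchanged moves into the offset; this is why the induction carries
    -- `a`.
    have i1 := ih (fun i => a i + v i 0) (fun i j => u i j.succ) (fun i j => v i j.succ)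
      (fun j => h j.succ)
    have i2 := ih (fun i => a i - v i 0) (fun i j => u i j.succ) (fun i j => v i j.succ)
      (fun j => h j.succ)
    refine (add_le_add i1 i2).trans (le_of_eq ?_)
    rw [← Finset.sum_add_distrib]
    refine Finset.sum_congr rfl fun τ _ => ?_
    congr 1 <;> refine iSup_congr fun i => ?_ <;> push_cast <;> ring

lemma signAverage_le_of_contraction {ι : Type*} [Finite ι] [Nonempty ι] {m : ℕ}
    (u v : ι → Fin m → ℝ) (h : ∀ j i i', |u i j - u i' j| ≤ |v i j - v i' j|) :
    signAverage u ≤ signAverage v := by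
  have := sum_signs_iSup_le_of_contraction 0 u v h
  simp only [Pi.zero_apply, zero_add] at this
  exact mul_le_mul_of_nonneg_left this (by positivity)

lemma signAverage_const_mul {ι : Type*} {m : ℕ} {c : ℝ} (hc : 0 ≤ c) (ℓ : ι → Fin m → ℝ) :
    signAverage (fun i j => c * ℓ i j) = c * signAverage ℓ := by
  unfold signAverage
  rw [mul_left_comm, Finset.mul_sum (a := c)]
  congr 1
  refine Finset.sum_congr rfl fun σ _ => ?_
  rw [Real.mul_iSup_of_nonneg hc]
  refine iSup_congr fun i => ?_
  rw [Finset.mul_sum]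
  exact Finset.sum_congr rfl fun j _ => by ring

lemma signAverage_neg {ι : Type*} {m : ℕ} (ℓ : ι → Fin m → ℝ) :
    signAverage (fun i j => -ℓ i j) = signAverage ℓ := by
  unfold signAverage
  rw [← Equiv.sum_comp (Equiv.neg (Fin m → ℤˣ))]
  simp

lemma signAverage_add_le {ι : Type*} [Finite ι] [Nonempty ι] {m : ℕ} (ℓ ℓ' : ι → Fin m → ℝ) :
    signAverage (fun i j => ℓ i j + ℓ' i j) ≤ signAverage ℓ + signAverage ℓ' := by
  unfold signAverage
  rw [← mul_add, ← Finset.sum_add_distrib]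
  refine mul_le_mul_of_nonneg_left (Finset.sum_le_sum fun σ _ => ciSup_le fun i => ?_)
    (by positivity)
  simp only [mul_add, Finset.sum_add_distrib]
  exact add_le_add (Finite.le_ciSup (fun i => ∑ j, (((σ j : ℤˣ) : ℤ) : ℝ) * ℓ i j) i)
    (Finite.le_ciSup (fun i => ∑ j, (((σ j : ℤˣ) : ℤ) : ℝ) * ℓ' i j) i)

lemma signAverage_sub_le {ι : Type*} [Finite ι] [Nonempty ι] {m : ℕ} (ℓ ℓ' : ι → Fin m → ℝ) :
    signAverage (fun i j => ℓ i j - ℓ' i j) ≤ signAverage ℓ + signAverage ℓ' := by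
  simpa only [sub_eq_add_neg, signAverage_neg ℓ'] using
    signAverage_add_le ℓ (fun i j => -ℓ' i j)

/-! ### Bounded differences and McDiarmid's inequality. -/

lemma abs_integral_le_of_forall_abs_le {Ω : Type*} [MeasurableSpace Ω] (P : Measure Ω)
    [IsProbabilityMeasure P] {f : Ω → ℝ} {C : ℝ} (h : ∀ x, |f x| ≤ C) : |∫ x, f x ∂P| ≤ C := by
  simpa using norm_integral_le_of_norm_le_const (μ := P) (f := f) (C := C) (ae_of_all _ h)

lemma integral_pi_fin_succ {Z : Type*} [MeasurableSpace Z] (μ : Measure Z)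
    [IsProbabilityMeasure μ] {m : ℕ} (f : (Fin (m + 1) → Z) → ℝ) (hf : Measurable f) {C : ℝ}
    (hC : ∀ S, |f S| ≤ C) :
    ∫ S, f S ∂(Measure.pi fun _ => μ) =
      ∫ s, ∫ z, f (Fin.cons z s) ∂μ ∂(Measure.pi fun _ : Fin m => μ) := by
  have hmp := (measurePreserving_piFinSuccAbove (fun _ : Fin (m + 1) => μ) 0).symm
  rw [← hmp.integral_comp']
  have hfe : ∀ p, f ((MeasurableEquiv.piFinSuccAbove (fun _ : Fin (m + 1) => Z) 0).symm p) =
      f (Fin.cons p.1 p.2) := by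
    intro p
    simp [MeasurableEquiv.piFinSuccAbove, Fin.insertNthEquiv, Fin.insertNth_zero']
  simp only [hfe]
  rw [integral_prod_symm]
  simp only [← hfe]
  exact Integrable.of_bound (hf.comp (MeasurableEquiv.measurable _)).aestronglyMeasurable C
    (ae_of_all _ fun p => hC _)

lemma exists_forall_mem_Icc_of_abs_sub_le {Z : Type*} [Nonempty Z] {f : Z → ℝ} {c : ℝ}
    (h : ∀ z z', |f z - f z'| ≤ c) : ∃ a, ∀ z, f z ∈ Set.Icc a (a + c) := by
  obtain ⟨z₀⟩ := ‹Nonempty Z›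
  have hb : BddBelow (Set.range f) := by
    refine ⟨f z₀ - c, ?_⟩
    rintro _ ⟨z, rfl⟩
    linarith [(abs_le.mp (h z₀ z)).2]
  have : Nonempty Z := ⟨z₀⟩
  refine ⟨⨅ z, f z, fun z => ⟨ciInf_le hb z, ?_⟩⟩
  rw [← sub_le_iff_le_add]
  exact le_ciInf fun z' => by linarith [(abs_le.mp (h z z')).2]

/-- The moment generating function bound behind McDiarmid's inequality. -/
lemma integral_exp_le_of_bounded_differences {Z : Type*} [MeasurableSpace Z] (μ : Measure Z)
    [IsProbabilityMeasure μ] {m : ℕ} (g : (Fin m → Z) → ℝ) (hg : Measurable g) {C c : ℝ}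
    (hC : ∀ S, |g S| ≤ C) (hc : ∀ S j z, |g S - g (Function.update S j z)| ≤ c) (t : ℝ) :
    ∫ S, Real.exp (t * (g S - ∫ S', g S' ∂(Measure.pi fun _ => μ))) ∂(Measure.pi fun _ => μ) ≤
      Real.exp (m * (c / 2) ^ 2 * t ^ 2 / 2) := by
  induction m with
  | zero =>
    have : ∀ S, g S = g default := fun S => by rw [Subsingleton.elim S default]
    simp [this]
  | succ m ih =>
    have : Nonempty Z := nonempty_of_isProbabilityMeasure μ
    have hc0 : 0 ≤ c :=
      (abs_nonneg _).trans (hc (fun _ => Classical.arbitrary Z) 0 (Classical.arbitrary Z))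
    set I := ∫ S, g S ∂(Measure.pi fun _ : Fin (m + 1) => μ) with hI
    -- Averaging out one coordinate preserves the bound `C` and the differences `c`, so the
    -- induction hypothesis applies to `G`; the remaining factor is a conditional moment generating
    -- function in that coordinate.
    set G : (Fin m → Z) → ℝ := fun s => ∫ z, g (Fin.cons z s) ∂μ with hG
    have hcons : Measurable fun p : (Fin m → Z) × Z => (Fin.cons p.2 p.1 : Fin (m + 1) → Z) := by
      refine measurable_pi_lambda _ fun j => ?_
      refine Fin.cases ?_ (fun i => ?_) j
      · simpa using measurable_snd
      · simpa using! (measurable_pi_apply i).comp measurable_fst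
    have hgc : Measurable fun p : (Fin m → Z) × Z => g (Fin.cons p.2 p.1) := hg.comp hcons
    have hgz : ∀ s, Measurable fun z => g (Fin.cons z s) := fun s =>
      hgc.comp measurable_prodMk_left
    have hGm : Measurable G :=
      (hgc.stronglyMeasurable.integral_prod_right' (ν := μ)).measurable
    have hint : ∀ s, Integrable (fun z => g (Fin.cons z s)) μ := fun s =>
      Integrable.of_bound (hgz s).aestronglyMeasurable C (ae_of_all _ fun z => hC _)
    have hGC : ∀ s, |G s| ≤ C := fun s =>
      abs_integral_le_of_forall_abs_le μ fun z => hC _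
    have hIG : I = ∫ s, G s ∂(Measure.pi fun _ => μ) := integral_pi_fin_succ μ g hg hC
    have hGc : ∀ s j z, |G s - G (Function.update s j z)| ≤ c := by
      intro s j z
      simp only [hG]
      rw [← integral_sub (hint _) (hint _)]
      refine abs_integral_le_of_forall_abs_le μ fun x => ?_
      have := hc (Fin.cons x s) j.succ z
      rwa [← Fin.cons_update] at this
    have hIC : |I| ≤ C := abs_integral_le_of_forall_abs_le _ hC
    have hexp : ∀ {α : Type _} (u : α → ℝ) (J : ℝ), (∀ x, |u x| ≤ C) → |J| ≤ C → ∀ x,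
        |Real.exp (t * (u x - J))| ≤ Real.exp (|t| * (2 * C)) := by
      intro α u J hu hJ x
      rw [Real.abs_exp, Real.exp_le_exp]
      refine (le_abs_self _).trans ?_
      rw [abs_mul]
      refine mul_le_mul_of_nonneg_left ?_ (abs_nonneg t)
      exact (abs_sub _ _).trans (by linarith [hu x])
    rw [integral_pi_fin_succ μ (fun S => Real.exp (t * (g S - I))) (by fun_prop)
      (hexp g I hC hIC)]
    have hinner : ∀ s, ∫ z, Real.exp (t * (g (Fin.cons z s) - I)) ∂μ ≤
        Real.exp ((c / 2) ^ 2 * t ^ 2 / 2) * Real.exp (t * (G s - I)) := by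
      intro s
      -- Hoeffding's lemma: with `s` frozen, the values lie in an interval of length `c`, which
      -- gives variance proxy `(c / 2) ^ 2`.
      obtain ⟨a, ha⟩ := exists_forall_mem_Icc_of_abs_sub_le
        (f := fun z => g (Fin.cons z s)) (c := c) (fun z z' => by
          have := hc (Fin.cons z s) 0 z'
          rwa [Fin.update_cons_zero] at this)
      have hsub := ProbabilityTheory.hasSubgaussianMGF_of_mem_Icc (μ := μ) (hgz s).aemeasurable
        (ae_of_all _ ha)
      have hmgf := hsub.mgf_le t
      have hnn : (((‖a + c - a‖₊ / 2) ^ 2 : NNReal) : ℝ) = (c / 2) ^ 2 := by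
        simp [abs_of_nonneg hc0, div_pow]
      rw [hnn, ProbabilityTheory.mgf] at hmgf
      have hsplit : ∀ z, Real.exp (t * (g (Fin.cons z s) - I)) =
          Real.exp (t * (g (Fin.cons z s) - G s)) * Real.exp (t * (G s - I)) := fun z => by
        rw [← Real.exp_add]; ring_nf
      simp only [hsplit]
      rw [integral_mul_const]
      exact mul_le_mul_of_nonneg_right hmgf (Real.exp_pos _).le
    have hIC' : Integrable (fun s => Real.exp (t * (G s - I))) (Measure.pi fun _ => μ) :=
      Integrable.of_bound (by fun_prop) _ (ae_of_all _ (hexp G I hGC hIC))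
    calc _ ≤ ∫ s, Real.exp ((c / 2) ^ 2 * t ^ 2 / 2) * Real.exp (t * (G s - I))
            ∂(Measure.pi fun _ => μ) := by
          refine integral_mono_of_nonneg (ae_of_all _ fun s => ?_) (hIC'.const_mul _)
            (ae_of_all _ hinner)
          exact integral_nonneg fun z => (Real.exp_pos _).le
      _ ≤ Real.exp ((c / 2) ^ 2 * t ^ 2 / 2) * Real.exp (m * (c / 2) ^ 2 * t ^ 2 / 2) := by
          rw [integral_const_mul, hIG]
          exact mul_le_mul_of_nonneg_left (ih G hGm hGC hGc) (Real.exp_pos _).le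
      _ = _ := by
          rw [← Real.exp_add]; push_cast; ring_nf

/-- McDiarmid's bounded differences inequality, for equal difference bounds. -/
lemma measureReal_ge_le_of_bounded_differences {Z : Type*} [MeasurableSpace Z] (μ : Measure Z)
    [IsProbabilityMeasure μ] {m : ℕ} (g : (Fin m → Z) → ℝ) (hg : Measurable g) {C c : ℝ}
    (hC : ∀ S, |g S| ≤ C) (hc : ∀ S j z, |g S - g (Function.update S j z)| ≤ c)
    {ε : ℝ} (hε : 0 ≤ ε) :
    (Measure.pi fun _ : Fin m => μ).real
        {S | ε ≤ g S - ∫ S', g S' ∂(Measure.pi fun _ => μ)} ≤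
      Real.exp (-2 * ε ^ 2 / (m * c ^ 2)) := by
  have hsub : ProbabilityTheory.HasSubgaussianMGF
      (fun S => g S - ∫ S', g S' ∂(Measure.pi fun _ => μ))
      ⟨m * (c / 2) ^ 2, by positivity⟩ (Measure.pi fun _ : Fin m => μ) := by
    refine ⟨fun t => ?_, fun t =>
      integral_exp_le_of_bounded_differences μ g hg hC hc t⟩
    refine Integrable.of_bound (by fun_prop) (Real.exp (|t| * (2 * C))) (ae_of_all _ fun S => ?_)
    have hI := abs_integral_le_of_forall_abs_le (Measure.pi fun _ : Fin m => μ) hC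
    rw [Real.norm_eq_abs, Real.abs_exp, Real.exp_le_exp]
    refine (le_abs_self _).trans ?_
    rw [abs_mul]
    refine mul_le_mul_of_nonneg_left ?_ (abs_nonneg t)
    exact (abs_sub _ _).trans (by linarith [hC S])
  refine (hsub.measure_ge_le hε).trans (le_of_eq ?_)
  congr 1
  change -ε ^ 2 / (2 * (m * (c / 2) ^ 2)) = _
  rw [show 2 * ((m : ℝ) * (c / 2) ^ 2) = m * c ^ 2 / 2 by ring, div_div_eq_mul_div]
  ring_nf

/-! ### Symmetrization. -/

lemma abs_ciSup_le_of_forall_abs_le {ι : Type*} [Finite ι] [Nonempty ι] {f : ι → ℝ} {C : ℝ}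
    (h : ∀ i, |f i| ≤ C) : |⨆ i, f i| ≤ C := by
  obtain ⟨i⟩ := ‹Nonempty ι›
  have : Nonempty ι := ⟨i⟩
  exact abs_le.mpr ⟨(abs_le.mp (h i)).1.trans (Finite.le_ciSup f i),
    ciSup_le fun i => (abs_le.mp (h i)).2⟩

lemma abs_sum_sign_mul_le {m : ℕ} (σ : Fin m → ℤˣ) {u : Fin m → ℝ} {C : ℝ}
    (h : ∀ j, |u j| ≤ C) : |∑ j, (((σ j : ℤˣ) : ℤ) : ℝ) * u j| ≤ m * C := by
  refine (Finset.abs_sum_le_sum_abs _ _).trans ?_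
  have : ∀ j ∈ Finset.univ, |(((σ j : ℤˣ) : ℤ) : ℝ) * u j| ≤ C := fun j _ => by
    rcases Int.units_eq_one_or (σ j) with h1 | h1 <;> simpa [h1] using h j
  simpa using Finset.sum_le_sum this

lemma abs_signAverage_le {ι : Type*} [Finite ι] [Nonempty ι] {m : ℕ} {ℓ : ι → Fin m → ℝ} {C : ℝ}
    (h : ∀ i j, |ℓ i j| ≤ C) : |signAverage ℓ| ≤ m * C := by
  unfold signAverage
  rw [abs_mul, abs_of_nonneg (by positivity : (0 : ℝ) ≤ 1 / 2 ^ m), one_div,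
    inv_mul_le_iff₀ (by positivity)]
  refine (Finset.abs_sum_le_sum_abs _ _).trans ?_
  have := Finset.sum_le_sum fun (σ : Fin m → ℤˣ) (_ : σ ∈ Finset.univ) =>
    abs_ciSup_le_of_forall_abs_le fun i => abs_sum_sign_mul_le σ (h i)
  refine this.trans (le_of_eq ?_)
  simp [Fintype.card_pi]

lemma measurable_signAverage {Ω ι : Type*} [MeasurableSpace Ω] [Countable ι] {m : ℕ}
    {ℓ : Ω → ι → Fin m → ℝ} (h : ∀ i j, Measurable fun ω => ℓ ω i j) :
    Measurable fun ω => signAverage (ℓ ω) := by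
  unfold signAverage
  refine Measurable.const_mul (Finset.measurable_sum _ fun σ _ => Measurable.iSup fun i => ?_) _
  exact Finset.measurable_sum _ fun j _ => (h i j).const_mul _

lemma integrable_of_measurable_of_forall_abs_le {Ω : Type*} [MeasurableSpace Ω] {P : Measure Ω}
    [IsFiniteMeasure P] {f : Ω → ℝ} {C : ℝ} (hf : Measurable f) (h : ∀ x, |f x| ≤ C) :
    Integrable f P :=
  Integrable.of_bound hf.aestronglyMeasurable C (ae_of_all _ h)

/-- The expectation of `sup_i (1/m) ∑ⱼ (f i (S'ⱼ) - f i (Sⱼ))` over a pair of independent samples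
is at most twice the Rademacher average. -/
lemma integral_iSup_ghost_le {Z ι : Type*} [MeasurableSpace Z] [Finite ι] [Nonempty ι]
    (μ : Measure Z) [IsProbabilityMeasure μ] {m : ℕ} (f : ι → Z → ℝ)
    (hf : ∀ i, Measurable (f i)) {C : ℝ} (hC : ∀ i z, |f i z| ≤ C) :
    ∫ p : Fin m → Z × Z, ⨆ i, ∑ j, (f i (p j).2 - f i (p j).1)
        ∂(Measure.pi fun _ => μ.prod μ) ≤
      2 * ∫ S : Fin m → Z, signAverage (fun i j => f i (S j)) ∂(Measure.pi fun _ => μ) := by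
  set Q := Measure.pi fun _ : Fin m => μ.prod μ
  have hd : ∀ i (z : Z × Z), |f i z.2 - f i z.1| ≤ C + C := fun i z =>
    (abs_sub _ _).trans (add_le_add (hC i _) (hC i _))
  have hdm : ∀ i (j : Fin m), Measurable fun p : Fin m → Z × Z => f i (p j).2 - f i (p j).1 :=
    fun i j => by
      have := hf i
      fun_prop
  -- Swapping the two points of pair `j` wherever `σ j = -1` preserves the law `Q` and flips the
  -- sign of that difference.
  have hsym : ∀ σ : Fin m → ℤˣ,
      ∫ p, ⨆ i, ∑ j, (f i (p j).2 - f i (p j).1) ∂Q =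
        ∫ p, ⨆ i, ∑ j, (((σ j : ℤˣ) : ℤ) : ℝ) * (f i (p j).2 - f i (p j).1) ∂Q := by
    intro σ
    have hT : MeasurePreserving
        (fun (p : Fin m → Z × Z) j => (if σ j = 1 then id else Prod.swap) (p j)) Q Q := by
      refine measurePreserving_pi _ _ fun j => ?_
      split_ifs
      · exact MeasurePreserving.id _
      · exact Measure.measurePreserving_swap
    rw [← hT.map_eq, integral_map hT.measurable.aemeasurable, hT.map_eq]
    · refine integral_congr_ae (ae_of_all _ fun p => iSup_congr fun i =>
        Finset.sum_congr rfl fun j _ => ?_)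
      rcases Int.units_eq_one_or (σ j) with h | h <;> simp [h]
    · exact (Measurable.iSup fun i =>
        Finset.measurable_sum _ fun j _ => hdm i j).aestronglyMeasurable
  have hav : ∫ p, ⨆ i, ∑ j, (f i (p j).2 - f i (p j).1) ∂Q =
      ∫ p, signAverage (fun i j => f i (p j).2 - f i (p j).1) ∂Q := by
    unfold signAverage
    rw [integral_const_mul, integral_finsetSum]
    · rw [← Finset.sum_congr rfl fun σ _ => hsym σ]
      simp [Fintype.card_pi]
    · intro σ _
      refine integrable_of_measurable_of_forall_abs_le (C := m * (C + C))
        (Measurable.iSup fun i => Finset.measurable_sum _ fun j _ => (hdm i j).const_mul _) fun p =>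
          abs_ciSup_le_of_forall_abs_le fun i => abs_sum_sign_mul_le σ fun j => hd i _
  have hm1 : MeasurePreserving (fun (p : Fin m → Z × Z) j => (p j).1) Q
      (Measure.pi fun _ => μ) := measurePreserving_pi (fun _ : Fin m => μ.prod μ) (fun _ => μ)
    fun _ => measurePreserving_fst
  have hm2 : MeasurePreserving (fun (p : Fin m → Z × Z) j => (p j).2) Q
      (Measure.pi fun _ => μ) := measurePreserving_pi (fun _ : Fin m => μ.prod μ) (fun _ => μ)
    fun _ => measurePreserving_snd
  have hsm : Measurable fun S : Fin m → Z => signAverage fun i j => f i (S j) :=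
    measurable_signAverage fun i j => (hf i).comp (measurable_pi_apply j)
  have hsC : ∀ S : Fin m → Z, |signAverage fun i j => f i (S j)| ≤ m * C := fun S =>
    abs_signAverage_le fun i j => hC i _
  have h1 : ∫ p, signAverage (fun i j => f i (p j).1) ∂Q =
      ∫ S : Fin m → Z, signAverage (fun i j => f i (S j)) ∂(Measure.pi fun _ => μ) := by
    rw [← hm1.map_eq, integral_map hm1.measurable.aemeasurable hsm.aestronglyMeasurable]
  have h2 : ∫ p, signAverage (fun i j => f i (p j).2) ∂Q =
      ∫ S : Fin m → Z, signAverage (fun i j => f i (S j)) ∂(Measure.pi fun _ => μ) := by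
    rw [← hm2.map_eq, integral_map hm2.measurable.aemeasurable hsm.aestronglyMeasurable]
  have i1 : Integrable (fun p : Fin m → Z × Z => signAverage fun i j => f i (p j).1) Q :=
    integrable_of_measurable_of_forall_abs_le (hsm.comp hm1.measurable) fun p => hsC _
  have i2 : Integrable (fun p : Fin m → Z × Z => signAverage fun i j => f i (p j).2) Q :=
    integrable_of_measurable_of_forall_abs_le (hsm.comp hm2.measurable) fun p => hsC _
  rw [hav, two_mul]
  nth_rw 1 [← h2]
  rw [← h1, ← integral_add i2 i1]
  exact integral_mono (integrable_of_measurable_of_forall_abs_le (measurable_signAverage hdm)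
    fun p => abs_signAverage_le fun i j => hd i _) (i2.add i1) fun p => signAverage_sub_le _ _

/-- Symmetrization: the expected supremum of the generalization gaps of a finite family is at most
twice the Rademacher complexity of the family. -/
lemma integral_iSup_generalizationGap_le {Z ι : Type*} [MeasurableSpace Z] [Finite ι] [Nonempty ι]
    (μ : Measure Z) [IsProbabilityMeasure μ] {m : ℕ} (hm : 0 < m) (f : ι → Z → ℝ)
    (hf : ∀ i, Measurable (f i)) {C : ℝ} (hC : ∀ i z, |f i z| ≤ C) :
    ∫ S : Fin m → Z, ⨆ i, generalizationGap μ S (f i) ∂(Measure.pi fun _ => μ) ≤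
      2 / m * ∫ S : Fin m → Z, signAverage (fun i j => f i (S j)) ∂(Measure.pi fun _ => μ) := by
  have hm' : (0 : ℝ) < m := by exact_mod_cast hm
  set P := Measure.pi fun _ : Fin m => μ
  -- A ghost sample `S'` replaces the expectation under `μ`.
  have hgap : ∀ i (S : Fin m → Z), generalizationGap μ S (f i) =
      (1 / m) * ∫ S', ∑ j, (f i (S' j) - f i (S j)) ∂P := by
    intro i S
    have hint : ∀ j : Fin m, Integrable (fun S' : Fin m → Z => f i (S' j)) P := fun j =>
      integrable_of_measurable_of_forall_abs_le ((hf i).comp (measurable_pi_apply j))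
        fun _ => hC i _
    have hev : ∀ j : Fin m, ∫ S', f i (S' j) ∂P = ∫ z, f i z ∂μ := fun j => by
      have := measurePreserving_eval (fun _ : Fin m => μ) j
      conv_rhs => rw [← this.map_eq]
      rw [integral_map this.measurable.aemeasurable (hf i).aestronglyMeasurable]
    rw [integral_finsetSum _ fun j _ => (?_ : Integrable (fun S' : Fin m → Z =>
      f i (S' j) - f i (S j)) P)]
    rotate_left
    · exact (hint j).sub (integrable_const _)
    simp only [integral_sub (hint _) (integrable_const _), hev, Finset.sum_sub_distrib]
    simp only [generalizationGap, integral_const, probReal_univ, one_smul, Finset.sum_const,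
      Finset.card_univ, Fintype.card_fin, nsmul_eq_mul]
    field_simp
  have hdm : ∀ i, Measurable fun q : (Fin m → Z) × (Fin m → Z) =>
      ∑ j, (f i (q.2 j) - f i (q.1 j)) := fun i => by
    have := hf i
    fun_prop
  have hdC : ∀ i (S S' : Fin m → Z), |∑ j, (f i (S' j) - f i (S j))| ≤ m * (C + C) := by
    intro i S S'
    refine (Finset.abs_sum_le_sum_abs _ _).trans ?_
    have := Finset.sum_le_sum fun (j : Fin m) (_ : j ∈ Finset.univ) =>
      (abs_sub (f i (S' j)) (f i (S j))).trans (add_le_add (hC i _) (hC i _))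
    simpa [mul_add] using this
  have hsm : Measurable fun q : (Fin m → Z) × (Fin m → Z) =>
      ⨆ i, ∑ j, (f i (q.2 j) - f i (q.1 j)) := Measurable.iSup hdm
  have hsC : ∀ S S' : Fin m → Z, |⨆ i, ∑ j, (f i (S' j) - f i (S j))| ≤ m * (C + C) :=
    fun S S' => abs_ciSup_le_of_forall_abs_le fun i => hdC i S S'
  have hpair : Integrable (fun q : (Fin m → Z) × (Fin m → Z) =>
      ⨆ i, ∑ j, (f i (q.2 j) - f i (q.1 j))) (P.prod P) :=
    integrable_of_measurable_of_forall_abs_le hsm fun q => hsC _ _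
  have hle : ∀ S, ⨆ i, generalizationGap μ S (f i) ≤
      (1 / m) * ∫ S', ⨆ i, ∑ j, (f i (S' j) - f i (S j)) ∂P := by
    intro S
    refine ciSup_le fun i => ?_
    rw [hgap]
    refine mul_le_mul_of_nonneg_left (integral_mono ?_ ?_ fun S' => ?_) (by positivity)
    · exact integrable_of_measurable_of_forall_abs_le ((hdm i).comp measurable_prodMk_left)
        fun S' => hdC i S S'
    · exact integrable_of_measurable_of_forall_abs_le (hsm.comp measurable_prodMk_left)
        fun S' => hsC S S'
    · exact Finite.le_ciSup (fun i => ∑ j, (f i (S' j) - f i (S j))) i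
  have hgm : Measurable fun S : Fin m → Z => ⨆ i, generalizationGap μ S (f i) := by
    refine Measurable.iSup fun i => ?_
    unfold generalizationGap
    have := hf i
    fun_prop
  have hgC : ∀ S : Fin m → Z, |⨆ i, generalizationGap μ S (f i)| ≤ (1 / m) * (m * (C + C)) := by
    intro S
    refine abs_ciSup_le_of_forall_abs_le fun i => ?_
    rw [hgap, abs_mul, abs_of_nonneg (by positivity : (0 : ℝ) ≤ 1 / m)]
    exact mul_le_mul_of_nonneg_left (abs_integral_le_of_forall_abs_le P fun S' => hdC i S S')
      (by positivity)
  calc _ ≤ ∫ S, (1 / m) * ∫ S', ⨆ i, ∑ j, (f i (S' j) - f i (S j)) ∂P ∂P :=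
        integral_mono (integrable_of_measurable_of_forall_abs_le hgm hgC)
          (hpair.integral_prod_left.const_mul _) hle
    _ = (1 / m) * ∫ q, ⨆ i, ∑ j, (f i (q.2 j) - f i (q.1 j)) ∂(P.prod P) := by
        rw [integral_const_mul, integral_prod _ hpair]
    _ = (1 / m) * ∫ p : Fin m → Z × Z, ⨆ i, ∑ j, (f i (p j).2 - f i (p j).1)
          ∂(Measure.pi fun _ => μ.prod μ) := by
        rw [← (measurePreserving_arrowProdEquivProdArrow Z Z (Fin m) (fun _ => μ)
          fun _ => μ).integral_comp']
        rfl
    _ ≤ (1 / m) * (2 * ∫ S, signAverage (fun i j => f i (S j)) ∂P) :=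
        mul_le_mul_of_nonneg_left (integral_iSup_ghost_le μ f hf hC) (by positivity)
    _ = _ := by ring

/-! ### Uniform deviations over a finite family. -/

/-- The one-sided uniform deviation bound for a finite family of functions with values in
`[0, M]`. -/
lemma measureReal_iSup_generalizationGap_ge_le {Z ι : Type*} [MeasurableSpace Z] [Finite ι]
    [Nonempty ι] (μ : Measure Z) [IsProbabilityMeasure μ] {m : ℕ} (hm : 0 < m) (f : ι → Z → ℝ)
    (hf : ∀ i, Measurable (f i)) {M : ℝ} (h0 : ∀ i z, 0 ≤ f i z) (hM : ∀ i z, f i z ≤ M)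
    {ε : ℝ} (hε : 0 ≤ ε) :
    (Measure.pi fun _ : Fin m => μ).real {S | ε ≤ (⨆ i, generalizationGap μ S (f i)) -
        2 / m * ∫ S : Fin m → Z, signAverage (fun i j => f i (S j)) ∂(Measure.pi fun _ => μ)} ≤
      Real.exp (-2 * ε ^ 2 / (m * (M / m) ^ 2)) := by
  have hm' : (0 : ℝ) < m := by exact_mod_cast hm
  have hC : ∀ i z, |f i z| ≤ M := fun i z => by rw [abs_of_nonneg (h0 i z)]; exact hM i z
  have hdiff : ∀ i (S : Fin m → Z) j z, generalizationGap μ S (f i) ≤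
      generalizationGap μ (Function.update S j z) (f i) + M / m := by
    intro i S j z
    -- Values in `[0, M]` make one replacement cost `M`, where a bound on `|f|` alone would cost `2
    -- * M`.
    have hs : ∑ k, f i (Function.update S j z k) ≤ ∑ k, f i (S k) + M := by
      rw [← Finset.add_sum_erase _ _ (Finset.mem_univ j),
        ← Finset.add_sum_erase Finset.univ (fun k => f i (S k)) (Finset.mem_univ j)]
      have : ∑ k ∈ Finset.univ.erase j, f i (Function.update S j z k) =
          ∑ k ∈ Finset.univ.erase j, f i (S k) :=
        Finset.sum_congr rfl fun k hk => by
          rw [Function.update_of_ne (Finset.ne_of_mem_erase hk)]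
      rw [this, Function.update_self]
      linarith [hM i z, h0 i (S j)]
    have := mul_le_mul_of_nonneg_left hs (by positivity : (0 : ℝ) ≤ 1 / m)
    rw [mul_add, one_div_mul_eq_div (m : ℝ) M] at this
    unfold generalizationGap
    linarith
  have hsup : ∀ (S : Fin m → Z) j z, (⨆ i, generalizationGap μ S (f i)) ≤
      (⨆ i, generalizationGap μ (Function.update S j z) (f i)) + M / m := fun S j z =>
    ciSup_le fun i => (hdiff i S j z).trans
      (by gcongr; exact Finite.le_ciSup (fun i => generalizationGap μ (Function.update S j z) (f i)) i)
  have hbound : ∀ S : Fin m → Z, |⨆ i, generalizationGap μ S (f i)| ≤ M + M := by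
    intro S
    refine abs_ciSup_le_of_forall_abs_le fun i => ?_
    refine (abs_sub _ _).trans (add_le_add (abs_integral_le_of_forall_abs_le μ (hC i)) ?_)
    rw [abs_mul, abs_of_nonneg (by positivity : (0 : ℝ) ≤ 1 / m), one_div, inv_mul_le_iff₀ hm']
    refine (Finset.abs_sum_le_sum_abs _ _).trans ?_
    simpa using Finset.sum_le_sum fun (j : Fin m) (_ : j ∈ Finset.univ) => hC i (S j)
  have hmeas : Measurable fun S : Fin m → Z => ⨆ i, generalizationGap μ S (f i) := by
    refine Measurable.iSup fun i => ?_
    unfold generalizationGap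
    have := hf i
    fun_prop
  refine le_trans (measureReal_mono ?_) (measureReal_ge_le_of_bounded_differences μ _ hmeas hbound
    (c := M / m) (fun S j z => abs_le.mpr ⟨?_, by linarith [hsup S j z]⟩) hε)
  · intro S hS
    have := integral_iSup_generalizationGap_le μ hm f hf hC
    simp only [Set.mem_ofPred_eq] at hS ⊢
    linarith
  -- The reverse inequality: start from the changed sample and restore coordinate `j`.
  · have := hsup (Function.update S j z) j (S j)
    rw [Function.update_idem, Function.update_eq_self] at this
    linarith

/-! ### Rademacher complexity of linear combinations. -/

/-- `sup_{f ∈ F} ∑ⱼ σⱼ f(sⱼ)` for a sign vector `σ`. -/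
def signSup {α : Type*} {m : ℕ} (F : Set (α → ℝ)) (s : Fin m → α) (σ : Fin m → ℤˣ) : ℝ :=
  sSup ((fun f : α → ℝ => ∑ i, (((σ i : ℤˣ) : ℤ) : ℝ) * f (s i)) '' F)

open scoped Pointwise in
lemma mul_empiricalRademacher {α : Type*} {m : ℕ} (hm : 0 < m) (F : Set (α → ℝ))
    (s : Fin m → α) :
    m * empiricalRademacher F s = (1 / 2 ^ m : ℝ) * ∑ σ : Fin m → ℤˣ, signSup F s σ := by
  have hm' : (m : ℝ) ≠ 0 := by exact_mod_cast hm.ne'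
  unfold empiricalRademacher
  rw [mul_left_comm, Finset.mul_sum (a := (m : ℝ))]
  congr 1
  refine Finset.sum_congr rfl fun σ _ => ?_
  have : (fun f : α → ℝ => (1 / m : ℝ) * ∑ i, (((σ i : ℤˣ) : ℤ) : ℝ) * f (s i)) '' F =
      (1 / m : ℝ) • ((fun f : α → ℝ => ∑ i, (((σ i : ℤˣ) : ℤ) : ℝ) * f (s i)) '' F) := by
    rw [← Set.image_smul, Set.image_image]
    rfl
  rw [this, Real.sSup_smul_of_nonneg (by positivity), smul_eq_mul, signSup, ← mul_assoc,
    mul_one_div_cancel hm', one_mul]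

lemma le_signSup {α : Type*} {m : ℕ} {F : Set (α → ℝ)} {C : ℝ} (hC : ∀ f ∈ F, ∀ x, |f x| ≤ C)
    (s : Fin m → α) (σ : Fin m → ℤˣ) {f : α → ℝ} (hf : f ∈ F) :
    ∑ i, (((σ i : ℤˣ) : ℤ) : ℝ) * f (s i) ≤ signSup F s σ := by
  refine le_csSup ⟨m * C, ?_⟩ ⟨f, hf, rfl⟩
  rintro _ ⟨f, hf, rfl⟩
  exact (le_abs_self _).trans (abs_sum_sign_mul_le σ fun j => hC f hf _)

/-- The bound uses `|C|` because for empty `F` the supremum is `0` while `C` may be negative. -/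
lemma abs_signSup_le {α : Type*} {m : ℕ} {F : Set (α → ℝ)} {C : ℝ}
    (hC : ∀ f ∈ F, ∀ x, |f x| ≤ C) (s : Fin m → α) (σ : Fin m → ℤˣ) :
    |signSup F s σ| ≤ m * |C| := by
  rcases F.eq_empty_or_nonempty with rfl | ⟨f, hf⟩
  · simp [signSup]; positivity
  have h : ∀ f ∈ F, |∑ i, (((σ i : ℤˣ) : ℤ) : ℝ) * f (s i)| ≤ m * |C| := fun f hf =>
    abs_sum_sign_mul_le σ fun j => (hC f hf _).trans (le_abs_self C)
  refine abs_le.mpr ⟨(abs_le.mp (h f hf)).1.trans (le_signSup hC s σ hf), ?_⟩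
  refine csSup_le ⟨_, f, hf, rfl⟩ ?_
  rintro _ ⟨f, hf, rfl⟩
  exact (abs_le.mp (h f hf)).2

lemma sum_signSup_neg {α : Type*} {m : ℕ} (F : Set (α → ℝ)) (s : Fin m → α) :
    ∑ σ : Fin m → ℤˣ, signSup F s (-σ) = ∑ σ : Fin m → ℤˣ, signSup F s σ :=
  Equiv.sum_comp (Equiv.neg (Fin m → ℤˣ)) (signSup F s)

/-- Pair `σ` with `-σ`: one and the same `f` contributes opposite values to the two suprema. -/
lemma sum_signSup_nonneg {α : Type*} {m : ℕ} {F : Set (α → ℝ)} {C : ℝ}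
    (hC : ∀ f ∈ F, ∀ x, |f x| ≤ C) (s : Fin m → α) :
    0 ≤ ∑ σ : Fin m → ℤˣ, signSup F s σ := by
  rcases F.eq_empty_or_nonempty with rfl | ⟨f, hf⟩
  · simp [signSup]
  have h2 : 0 ≤ ∑ σ : Fin m → ℤˣ, (signSup F s σ + signSup F s (-σ)) := by
    refine Finset.sum_nonneg fun σ _ => ?_
    have h1 := le_signSup hC s σ hf
    have h2 := le_signSup hC s (-σ) hf
    simp only [Pi.neg_apply, Units.val_neg, Int.cast_neg, neg_mul, Finset.sum_neg_distrib] at h2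
    linarith
  rw [Finset.sum_add_distrib, sum_signSup_neg] at h2
  linarith

lemma empiricalRademacher_nonneg {α : Type*} {m : ℕ} (hm : 0 < m) {F : Set (α → ℝ)} {C : ℝ}
    (hC : ∀ f ∈ F, ∀ x, |f x| ≤ C) (s : Fin m → α) : 0 ≤ empiricalRademacher F s := by
  have hm' : (0 : ℝ) < m := by exact_mod_cast hm
  refine nonneg_of_mul_nonneg_right ?_ hm'
  rw [mul_empiricalRademacher hm]
  exact mul_nonneg (by positivity) (sum_signSup_nonneg hC s)

/-- The zero function makes both suprema non-negative, so their sum dominates the absolute value of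
the sign sum, and a weight of either sign is allowed. -/
lemma mul_sum_sign_le_of_zero_mem {α : Type*} {m : ℕ} {F : Set (α → ℝ)} {C : ℝ}
    (hC : ∀ f ∈ F, ∀ x, |f x| ≤ C) (h0 : (0 : α → ℝ) ∈ F) (s : Fin m → α) (σ : Fin m → ℤˣ)
    {f : α → ℝ} (hf : f ∈ F) {w β : ℝ} (hw : |w| ≤ β) :
    w * ∑ j, (((σ j : ℤˣ) : ℤ) : ℝ) * f (s j) ≤ β * (signSup F s σ + signSup F s (-σ)) := by
  have h1 := le_signSup hC s σ hf
  have h2 := le_signSup hC s (-σ) hf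
  have h3 := le_signSup hC s σ h0
  have h4 := le_signSup hC s (-σ) h0
  simp only [Pi.neg_apply, Units.val_neg, Int.cast_neg, neg_mul, Finset.sum_neg_distrib,
    Pi.zero_apply, mul_zero, Finset.sum_const_zero] at h2 h3 h4
  have h5 : |∑ j, (((σ j : ℤˣ) : ℤ) : ℝ) * f (s j)| ≤ signSup F s σ + signSup F s (-σ) :=
    abs_le.mpr ⟨by linarith, by linarith⟩
  calc _ ≤ |w| * |∑ j, (((σ j : ℤˣ) : ℤ) : ℝ) * f (s j)| := by
        rw [← abs_mul]; exact le_abs_self _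
    _ ≤ _ := mul_le_mul hw h5 (abs_nonneg _) ((abs_nonneg w).trans hw)

/-- A negative weight amounts to flipping `σ`. The choice between the two suprema depends on `w`
alone, so for fixed weights it disappears after summing over `σ`. -/
lemma mul_sum_sign_le {α : Type*} {m : ℕ} {F : Set (α → ℝ)} {C : ℝ}
    (hC : ∀ f ∈ F, ∀ x, |f x| ≤ C) (s : Fin m → α) (σ : Fin m → ℤˣ)
    {f : α → ℝ} (hf : f ∈ F) (w : ℝ) :
    w * ∑ j, (((σ j : ℤˣ) : ℤ) : ℝ) * f (s j) ≤
      |w| * if 0 ≤ w then signSup F s σ else signSup F s (-σ) := by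
  split_ifs with h
  · rw [abs_of_nonneg h]
    exact mul_le_mul_of_nonneg_left (le_signSup hC s σ hf) h
  · have h2 := le_signSup hC s (-σ) hf
    simp only [Pi.neg_apply, Units.val_neg, Int.cast_neg, neg_mul, Finset.sum_neg_distrib] at h2
    push Not at h
    rw [abs_of_neg h]
    nlinarith

/-- A linear combination class has at most `2 D β` times the complexity of its base class. -/
lemma signAverage_sum_mul_le {α ι : Type*} [Finite ι] [Nonempty ι] {m D : ℕ} (hm : 0 < m)
    {F : Set (α → ℝ)} {C : ℝ} (hC : ∀ f ∈ F, ∀ x, |f x| ≤ C) (w : ι → Fin D → ℝ) {β : ℝ}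
    (hw : ∀ i, ‖w i‖ ≤ β) (f : ι → Fin D → α → ℝ) (hf : ∀ i d, f i d ∈ F)
    (h : (∀ i i', w i = w i') ∨ (0 : α → ℝ) ∈ F) (s : Fin m → α) :
    signAverage (fun i j => ∑ d, w i d * f i d (s j)) ≤
      m * (2 * (D * β * empiricalRademacher F s)) := by
  have hβ : 0 ≤ β := (norm_nonneg _).trans (hw (Classical.arbitrary ι))
  have hwd : ∀ i d, |w i d| ≤ β := fun i d => (norm_le_pi_norm (w i) d).trans (hw i)
  have hswap : ∀ (σ : Fin m → ℤˣ) i,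
      ∑ j, (((σ j : ℤˣ) : ℤ) : ℝ) * ∑ d, w i d * f i d (s j) =
        ∑ d, w i d * ∑ j, (((σ j : ℤˣ) : ℤ) : ℝ) * f i d (s j) := by
    intro σ i
    simp only [Finset.mul_sum]
    rw [Finset.sum_comm]
    exact Finset.sum_congr rfl fun d _ => Finset.sum_congr rfl fun j _ => by ring
  have hrhs : m * (2 * (D * β * empiricalRademacher F s)) =
      (1 / 2 ^ m : ℝ) * (2 * (D * β * ∑ σ : Fin m → ℤˣ, signSup F s σ)) := by
    linear_combination (2 * (D * β)) * mul_empiricalRademacher hm F s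
  rw [hrhs]
  refine mul_le_mul_of_nonneg_left ?_ (by positivity)
  simp only [hswap]
  rcases h with h | h
  · obtain ⟨i₀⟩ := ‹Nonempty ι›
    have : Nonempty ι := ⟨i₀⟩
    calc _ ≤ ∑ σ : Fin m → ℤˣ, ∑ d,
            |w i₀ d| * if 0 ≤ w i₀ d then signSup F s σ else signSup F s (-σ) := by
          refine Finset.sum_le_sum fun σ _ => ciSup_le fun i => Finset.sum_le_sum fun d _ => ?_
          rw [h i i₀]
          exact mul_sum_sign_le hC s σ (hf i d) _
      _ = ∑ d, |w i₀ d| * ∑ σ : Fin m → ℤˣ, signSup F s σ := by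
          rw [Finset.sum_comm]
          refine Finset.sum_congr rfl fun d _ => ?_
          rw [← Finset.mul_sum]
          split_ifs
          · rfl
          · rw [sum_signSup_neg]
      _ ≤ ∑ _d : Fin D, β * ∑ σ : Fin m → ℤˣ, signSup F s σ :=
          Finset.sum_le_sum fun d _ =>
            mul_le_mul_of_nonneg_right (hwd i₀ d) (sum_signSup_nonneg hC s)
      _ = D * β * ∑ σ : Fin m → ℤˣ, signSup F s σ := by simp [mul_assoc]
      -- Fixed weights need only half of the bound; the factor `2` is for the case `0 ∈ F`.
      _ ≤ _ := by
          have := mul_nonneg (mul_nonneg (Nat.cast_nonneg' (α := ℝ) D) hβ)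
            (sum_signSup_nonneg hC s)
          linarith
  · calc _ ≤ ∑ σ : Fin m → ℤˣ, ∑ _d : Fin D, β * (signSup F s σ + signSup F s (-σ)) :=
          Finset.sum_le_sum fun σ _ => ciSup_le fun i => Finset.sum_le_sum fun d _ =>
            mul_sum_sign_le_of_zero_mem hC h s σ (hf i d) (hwd i d)
      _ = _ := by
          simp only [Finset.sum_const, Finset.card_univ, Fintype.card_fin, nsmul_eq_mul,
            ← Finset.mul_sum, Finset.sum_add_distrib, sum_signSup_neg]
          ring

/-- Sign sums are continuous under pointwise convergence. A countable supremum is what makes the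
empirical complexity measurable. -/
lemma signSup_eq_of_dense {α : Type*} {m : ℕ} {F F₀ : Set (α → ℝ)} {C : ℝ}
    (hC : ∀ f ∈ F, ∀ x, |f x| ≤ C) (hsub : F₀ ⊆ F)
    (hd : ∀ f ∈ F, ∃ u : ℕ → α → ℝ, (∀ n, u n ∈ F₀) ∧
      ∀ x, Tendsto (fun n => u n x) atTop (𝓝 (f x)))
    (s : Fin m → α) (σ : Fin m → ℤˣ) : signSup F s σ = signSup F₀ s σ := by
  rcases F.eq_empty_or_nonempty with rfl | ⟨f, hf⟩
  · rw [Set.subset_empty_iff.mp hsub]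
  obtain ⟨u, hu, -⟩ := hd f hf
  refine le_antisymm (csSup_le ⟨_, f, hf, rfl⟩ ?_) (csSup_le ⟨_, u 0, hu 0, rfl⟩ ?_)
  · rintro _ ⟨f, hf, rfl⟩
    obtain ⟨u, hu, hlim⟩ := hd f hf
    refine le_of_tendsto (tendsto_finsetSum _ fun j _ => (hlim (s j)).const_mul _)
      (Eventually.of_forall fun n => ?_)
    exact le_signSup (fun f hf => hC f (hsub hf)) s σ (hu n)
  · rintro _ ⟨f, hf, rfl⟩
    exact le_signSup hC s σ (hsub hf)

lemma IsRegularClass.integrable_empiricalRademacher {α Z : Type*} [MeasurableSpace α]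
    [MeasurableSpace Z] {F : Set (α → ℝ)} (hF : IsRegularClass F) {m : ℕ} (hm : 0 < m)
    {proj : Z → α} (hproj : Measurable proj) (P : Measure (Fin m → Z)) [IsFiniteMeasure P] :
    Integrable (fun S => empiricalRademacher F fun i => proj (S i)) P := by
  obtain ⟨C, hC⟩ := hF.bounded
  obtain ⟨F₀, hsub, hcount, hd⟩ := hF.separable
  have hm' : (m : ℝ) ≠ 0 := by exact_mod_cast hm.ne'
  have heq : ∀ S : Fin m → Z, empiricalRademacher F (fun i => proj (S i)) =
      (1 / m) * ((1 / 2 ^ m) * ∑ σ : Fin m → ℤˣ, signSup F (fun i => proj (S i)) σ) := fun S => by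
    rw [← mul_empiricalRademacher hm]
    field_simp
  simp only [heq]
  refine (Integrable.const_mul (integrable_finsetSum _ fun σ _ => ?_) _).const_mul _
  refine integrable_of_measurable_of_forall_abs_le ?_ fun S => abs_signSup_le hC _ σ
  simp only [signSup_eq_of_dense hC hsub hd]
  simp only [signSup, sSup_image']
  have := hcount.to_subtype
  refine Measurable.iSup fun f => Finset.measurable_sum _ fun j _ => Measurable.const_mul ?_ _
  exact (hF.measurable _ (hsub f.2)).comp (hproj.comp (measurable_pi_apply j))

lemma IsRegularClass.rademacherComplexity_nonneg {α Z : Type*} [MeasurableSpace α]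
    [MeasurableSpace Z] {F : Set (α → ℝ)} (hF : IsRegularClass F) {m : ℕ} (hm : 0 < m)
    (proj : Z → α) (μ : Measure Z) : 0 ≤ rademacherComplexity μ m proj F := by
  obtain ⟨C, hC⟩ := hF.bounded
  exact integral_nonneg fun S => empiricalRademacher_nonneg hm hC _

/-! ### Truncated energies. -/

/-- Truncation of a real number to `[-a, a]`. -/
def truncate (a x : ℝ) : ℝ := max (-a) (min a x)

lemma abs_truncate_le {a : ℝ} (ha : 0 ≤ a) (x : ℝ) : |truncate a x| ≤ a :=
  abs_le.mpr ⟨le_max_left _ _, max_le (by linarith) (min_le_left _ _)⟩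

lemma truncate_of_abs_le {a x : ℝ} (h : |x| ≤ a) : truncate a x = x := by
  obtain ⟨h1, h2⟩ := abs_le.mp h
  rw [truncate, min_eq_right h2, max_eq_right h1]

lemma abs_truncate_sub_le (a x y : ℝ) : |truncate a x - truncate a y| ≤ |x - y| := by
  unfold truncate
  rw [max_comm (-a), max_comm (-a), min_comm a, min_comm a]
  exact (abs_max_sub_max_le_abs _ _ _).trans (abs_inf_sub_inf_le_abs _ _ _)

lemma continuous_truncate (a : ℝ) : Continuous (truncate a) := by
  unfold truncate
  fun_prop

/-- The energy of a pair of linear combinations truncated at `a` and `b`. -/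
def truncatedEnergy {X Y : Type*} {D₁ D₂ : ℕ} (a b : ℝ) (w₁ : Fin D₁ → ℝ) (f₁ : Fin D₁ → X → ℝ)
    (w₂ : Fin D₂ → ℝ) (f₂ : Fin D₂ → Y → ℝ) : X × Y → ℝ :=
  implicitEnergy (fun x => truncate a (∑ d, w₁ d * f₁ d x))
    (fun y => truncate b (∑ d, w₂ d * f₂ d y))

lemma truncatedEnergy_le {X Y : Type*} {D₁ D₂ : ℕ} {a b : ℝ} (ha : 0 ≤ a) (hb : 0 ≤ b)
    (w₁ : Fin D₁ → ℝ) (f₁ : Fin D₁ → X → ℝ) (w₂ : Fin D₂ → ℝ) (f₂ : Fin D₂ → Y → ℝ) (z : X × Y) :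
    truncatedEnergy a b w₁ f₁ w₂ f₂ z ≤ a ^ 2 + b ^ 2 := by
  obtain ⟨h1, h2⟩ := abs_le.mp (abs_truncate_le ha (∑ d, w₁ d * f₁ d z.1))
  obtain ⟨h3, h4⟩ := abs_le.mp (abs_truncate_le hb (∑ d, w₂ d * f₂ d z.2))
  simp only [truncatedEnergy, implicitEnergy, Real.norm_eq_abs, sq_abs]
  generalize truncate a _ = u at *
  generalize truncate b _ = v at *
  -- The bound rests on `½ (u - v)² = u² + v² - ½ (u + v)²`.
  nlinarith [sq_nonneg (u + v), mul_nonneg (sub_nonneg.mpr h2) (sub_nonneg.mpr h1),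
    mul_nonneg (sub_nonneg.mpr h4) (sub_nonneg.mpr h3)]

lemma truncatedEnergy_nonneg {X Y : Type*} {D₁ D₂ : ℕ} (a b : ℝ)
    (w₁ : Fin D₁ → ℝ) (f₁ : Fin D₁ → X → ℝ) (w₂ : Fin D₂ → ℝ) (f₂ : Fin D₂ → Y → ℝ) (z : X × Y) :
    0 ≤ truncatedEnergy a b w₁ f₁ w₂ f₂ z := by
  unfold truncatedEnergy implicitEnergy
  positivity

lemma measurable_truncatedEnergy {X Y : Type*} [MeasurableSpace X] [MeasurableSpace Y]
    {D₁ D₂ : ℕ} (a b : ℝ) (w₁ : Fin D₁ → ℝ) {f₁ : Fin D₁ → X → ℝ} (hf₁ : ∀ d, Measurable (f₁ d))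
    (w₂ : Fin D₂ → ℝ) {f₂ : Fin D₂ → Y → ℝ} (hf₂ : ∀ d, Measurable (f₂ d)) :
    Measurable (truncatedEnergy a b w₁ f₁ w₂ f₂) := by
  have h1 : Measurable fun z : X × Y => truncate a (∑ d, w₁ d * f₁ d z.1) :=
    (continuous_truncate a).measurable.comp
      (Finset.measurable_sum _ fun d _ => ((hf₁ d).comp measurable_fst).const_mul _)
  have h2 : Measurable fun z : X × Y => truncate b (∑ d, w₂ d * f₂ d z.2) :=
    (continuous_truncate b).measurable.comp
      (Finset.measurable_sum _ fun d _ => ((hf₂ d).comp measurable_snd).const_mul _)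
  unfold truncatedEnergy implicitEnergy
  exact ((h1.sub h2).norm.pow_const 2).const_mul _

/-- The function `t ↦ t² / 2` has slope at most `a + b` on `[-(a + b), a + b]`. Contracting to the
difference first, then using subadditivity, leaves two scalar contractions that remove the
truncations. -/
lemma signAverage_half_sq_sub_le {ι : Type*} [Finite ι] [Nonempty ι] {m : ℕ} {a b : ℝ}
    (ha : 0 ≤ a) (hb : 0 ≤ b) (g₁ g₂ : ι → Fin m → ℝ) :
    signAverage (fun i j => (1 / 2 : ℝ) * ‖truncate a (g₁ i j) - truncate b (g₂ i j)‖ ^ 2) ≤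
      (a + b) * (signAverage g₁ + signAverage g₂) := by
  calc _ ≤ signAverage
          (fun i j => (a + b) * (truncate a (g₁ i j) - truncate b (g₂ i j))) := by
        refine signAverage_le_of_contraction _ _ fun j i i' => ?_
        have h1 := abs_truncate_le ha (g₁ i j)
        have h2 := abs_truncate_le ha (g₁ i' j)
        have h3 := abs_truncate_le hb (g₂ i j)
        have h4 := abs_truncate_le hb (g₂ i' j)
        generalize truncate a (g₁ i j) = u at *
        generalize truncate a (g₁ i' j) = u' at *
        generalize truncate b (g₂ i j) = v at *
        generalize truncate b (g₂ i' j) = v' at *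
        have e : (1 / 2 : ℝ) * ‖u - v‖ ^ 2 - (1 / 2 : ℝ) * ‖u' - v'‖ ^ 2 =
            ((u - v + (u' - v')) / 2) * ((u - v) - (u' - v')) := by
          simp only [Real.norm_eq_abs, sq_abs]; ring
        rw [e, ← mul_sub, abs_mul, abs_mul]
        refine mul_le_mul_of_nonneg_right ?_ (abs_nonneg _)
        rw [abs_of_nonneg (add_nonneg ha hb)]
        rw [abs_le] at *
        constructor <;> linarith
    _ = (a + b) * signAverage (fun i j => truncate a (g₁ i j) - truncate b (g₂ i j)) :=
        signAverage_const_mul (add_nonneg ha hb) _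
    _ ≤ (a + b) * (signAverage (fun i j => truncate a (g₁ i j)) +
          signAverage (fun i j => truncate b (g₂ i j))) :=
        mul_le_mul_of_nonneg_left (signAverage_sub_le _ _) (add_nonneg ha hb)
    _ ≤ _ := by
        refine mul_le_mul_of_nonneg_left (add_le_add ?_ ?_) (add_nonneg ha hb)
        · exact signAverage_le_of_contraction _ _ fun j i i' => abs_truncate_sub_le _ _ _
        · exact signAverage_le_of_contraction _ _ fun j i i' => abs_truncate_sub_le _ _ _

/-- Uniform deviation bound for a finite family of truncated energies. -/
lemma measure_iUnion_generalizationGap_gt_le {X Y ι : Type*} [MeasurableSpace X]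
    [MeasurableSpace Y] [Finite ι] [Nonempty ι] (μ : Measure (X × Y)) [IsProbabilityMeasure μ]
    {m : ℕ} (hm : 0 < m) {D₁ D₂ : ℕ} {a b : ℝ} (ha : 0 ≤ a) (hb : 0 ≤ b)
    {F₁ : Set (X → ℝ)} (hF₁ : IsRegularClass F₁) {F₂ : Set (Y → ℝ)} (hF₂ : IsRegularClass F₂)
    (w₁ : ι → Fin D₁ → ℝ) {β₁ : ℝ} (hw₁ : ∀ i, ‖w₁ i‖ ≤ β₁)
    (w₂ : ι → Fin D₂ → ℝ) {β₂ : ℝ} (hw₂ : ∀ i, ‖w₂ i‖ ≤ β₂)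
    (f₁ : ι → Fin D₁ → X → ℝ) (hf₁ : ∀ i d, f₁ i d ∈ F₁)
    (f₂ : ι → Fin D₂ → Y → ℝ) (hf₂ : ∀ i d, f₂ i d ∈ F₂)
    (h₁ : (∀ i i', w₁ i = w₁ i') ∨ (0 : X → ℝ) ∈ F₁)
    (h₂ : (∀ i i', w₂ i = w₂ i') ∨ (0 : Y → ℝ) ∈ F₂)
    {δ : ℝ} (hδ : δ ∈ Set.Ioo (0 : ℝ) 1) :
    (Measure.pi fun _ : Fin m => μ) (⋃ i, {S |
        8 * (a + b) * (D₁ * β₁ * rademacherComplexity μ m Prod.fst F₁ +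
            D₂ * β₂ * rademacherComplexity μ m Prod.snd F₂) +
          (a ^ 2 + b ^ 2) * √(Real.log (2 / δ) / (2 * m)) <
        generalizationGap μ S (truncatedEnergy a b (w₁ i) (f₁ i) (w₂ i) (f₂ i))}) ≤
      ENNReal.ofReal δ := by
  have hm' : (0 : ℝ) < m := by exact_mod_cast hm
  obtain ⟨C₁, hC₁⟩ := hF₁.bounded
  obtain ⟨C₂, hC₂⟩ := hF₂.bounded
  set P := Measure.pi fun _ : Fin m => μ
  set E : ι → X × Y → ℝ := fun i => truncatedEnergy a b (w₁ i) (f₁ i) (w₂ i) (f₂ i)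
  set J := a ^ 2 + b ^ 2 with hJ
  have hEm : ∀ i, Measurable (E i) := fun i =>
    measurable_truncatedEnergy a b _ (fun d => hF₁.measurable _ (hf₁ i d)) _
      fun d => hF₂.measurable _ (hf₂ i d)
  have hE0 : ∀ i z, 0 ≤ E i z := fun i z => truncatedEnergy_nonneg _ _ _ _ _ _ _
  have hEJ : ∀ i z, E i z ≤ J := fun i z => truncatedEnergy_le ha hb _ _ _ _ _
  have hβ₁ : 0 ≤ β₁ := (norm_nonneg _).trans (hw₁ (Classical.arbitrary ι))
  have hβ₂ : 0 ≤ β₂ := (norm_nonneg _).trans (hw₂ (Classical.arbitrary ι))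
  have hR₁ : 0 ≤ D₁ * β₁ * rademacherComplexity μ m Prod.fst F₁ :=
    mul_nonneg (by positivity) (hF₁.rademacherComplexity_nonneg hm _ μ)
  have hR₂ : 0 ≤ D₂ * β₂ * rademacherComplexity μ m Prod.snd F₂ :=
    mul_nonneg (by positivity) (hF₂.rademacherComplexity_nonneg hm _ μ)
  set R := D₁ * β₁ * rademacherComplexity μ m Prod.fst F₁ +
    D₂ * β₂ * rademacherComplexity μ m Prod.snd F₂ with hR
  have hR0 : 0 ≤ R := add_nonneg hR₁ hR₂
  have hsign : ∫ S : Fin m → X × Y, signAverage (fun i j => E i (S j)) ∂P ≤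
      m * (2 * (a + b) * R) := by
    have i₁ := (hF₁.integrable_empiricalRademacher hm measurable_fst P).const_mul
      ((a + b) * (m * (2 * (D₁ * β₁))))
    have i₂ := (hF₂.integrable_empiricalRademacher hm measurable_snd P).const_mul
      ((a + b) * (m * (2 * (D₂ * β₂))))
    have hle : ∀ S : Fin m → X × Y, signAverage (fun i j => E i (S j)) ≤
        (a + b) * (m * (2 * (D₁ * β₁))) * empiricalRademacher F₁ (fun j => (S j).1) +
          (a + b) * (m * (2 * (D₂ * β₂))) * empiricalRademacher F₂ (fun j => (S j).2) := by
      intro S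
      have k₁ := signAverage_sum_mul_le hm hC₁ w₁ hw₁ f₁ hf₁ h₁ fun j => (S j).1
      have k₂ := signAverage_sum_mul_le hm hC₂ w₂ hw₂ f₂ hf₂ h₂ fun j => (S j).2
      refine (signAverage_half_sq_sub_le ha hb (fun i j => ∑ d, w₁ i d * f₁ i d (S j).1)
        (fun i j => ∑ d, w₂ i d * f₂ i d (S j).2)).trans ?_
      refine (mul_le_mul_of_nonneg_left (add_le_add k₁ k₂) (add_nonneg ha hb)).trans (le_of_eq ?_)
      ring
    have hint : Integrable (fun S : Fin m → X × Y => signAverage fun i j => E i (S j)) P :=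
      integrable_of_measurable_of_forall_abs_le
        (measurable_signAverage fun i j => (hEm i).comp (measurable_pi_apply j))
        fun S => abs_signAverage_le (C := J) fun i j => by
          rw [abs_of_nonneg (hE0 i _)]; exact hEJ i _
    refine (integral_mono hint (i₁.add i₂) hle).trans (le_of_eq ?_)
    simp only [Pi.add_apply]
    rw [integral_add i₁ i₂, integral_const_mul, integral_const_mul, hR]
    unfold rademacherComplexity
    ring
  have hL : 0 ≤ Real.log (2 / δ) :=
    Real.log_nonneg ((le_div_iff₀ hδ.1).mpr (by linarith [hδ.2]))
  set ε := J * √(Real.log (2 / δ) / (2 * m)) with hε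
  have hJ0 : 0 ≤ J := by positivity
  have hε0 : 0 ≤ ε := by positivity
  -- The deviation exponent divides by `J`, so `J = 0` is separate; then all energies vanish.
  rcases hJ0.eq_or_lt with hJz | hJpos
  · have hEz : ∀ i z, E i z = 0 := fun i z => le_antisymm ((hEJ i z).trans hJz.symm.le) (hE0 i z)
    have hempty : (⋃ i, {S : Fin m → X × Y |
        8 * (a + b) * R + ε < generalizationGap μ S (E i)}) = ∅ := by
      refine Set.iUnion_eq_empty.mpr fun i => Set.eq_empty_iff_forall_notMem.mpr fun S hS => ?_
      simp only [Set.mem_ofPred_eq, generalizationGap, hEz, integral_zero, Finset.sum_const_zero,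
        mul_zero, sub_zero] at hS
      exact absurd hS (not_lt.mpr (by positivity))
    rw [hempty, measure_empty]
    exact zero_le
  · have hdev := measureReal_iSup_generalizationGap_ge_le μ hm E hEm hE0 hEJ hε0
    have hexp : Real.exp (-2 * ε ^ 2 / (m * (J / m) ^ 2)) = δ / 2 := by
      rw [hε, mul_pow, Real.sq_sqrt (by positivity)]
      have : -2 * (J ^ 2 * (Real.log (2 / δ) / (2 * m))) / (m * (J / m) ^ 2) =
          Real.log (δ / 2) := by
        rw [← inv_div δ 2, Real.log_inv]
        field_simp
      rw [this, Real.exp_log (by linarith [hδ.1])]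
    rw [hexp] at hdev
    rw [← ofReal_measureReal]
    refine ENNReal.ofReal_le_ofReal (le_trans (measureReal_mono ?_) (hdev.trans
      (by linarith [hδ.1])))
    refine Set.iUnion_subset fun i S hS => ?_
    simp only [Set.mem_ofPred_eq] at hS ⊢
    have h1 := Finite.le_ciSup (fun i => generalizationGap μ S (E i)) i
    have h2 := mul_le_mul_of_nonneg_left hsign (by positivity : (0 : ℝ) ≤ 2 / m)
    -- Symmetrization and the linear combinations contribute a factor `2` each; the remaining half
    -- of the `8` is slack, as is the deviation probability `δ / 2`.
    have h3 : 2 / (m : ℝ) * (m * (2 * (a + b) * R)) = 4 * (a + b) * R := by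
      field_simp; ring
    have h4 : 0 ≤ (a + b) * R := mul_nonneg (add_nonneg ha hb) hR0
    linarith

/-! ### Diversity and the passage to the full class. -/

/-- Continuity from below along an enumeration: `p` does not depend on the size of the family. `Fin
(n + 1)` keeps the finite families non-empty. -/
lemma measure_iUnion_le_of_forall_finite {Ω ι : Type*} [MeasurableSpace Ω] [Countable ι]
    [Nonempty ι] (P : Measure Ω) (A : ι → Set Ω) {p : ENNReal}
    (h : ∀ (n : ℕ) (e : Fin (n + 1) → ι), P (⋃ k, A (e k)) ≤ p) : P (⋃ i, A i) ≤ p := by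
  obtain ⟨e, he⟩ := exists_surjective_nat ι
  have hmono : Monotone fun n : ℕ => ⋃ k : Fin (n + 1), A (e k) := by
    intro n n' hn
    refine Set.iUnion_subset fun k => ?_
    exact Set.subset_iUnion (fun k : Fin (n' + 1) => A (e k)) (Fin.castLE (by omega) k)
  have heq : ⋃ i, A i = ⋃ n : ℕ, ⋃ k : Fin (n + 1), A (e k) := by
    ext x
    simp only [Set.mem_iUnion]
    constructor
    · rintro ⟨i, hi⟩
      obtain ⟨n, rfl⟩ := he i
      exact ⟨n, Fin.last n, by simpa using hi⟩
    · rintro ⟨n, k, hk⟩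
      exact ⟨_, hk⟩
  rw [heq, hmono.measure_iUnion]
  exact iSup_le fun n => h n _

/-- Lagrange's identity against the all-ones vector; it turns diversity into an upper bound on `(∑ v
i) ^ 2`. -/
lemma half_sum_offDiag_sub_sq {D : ℕ} (v : Fin D → ℝ) :
    (1 / 2 : ℝ) * ∑ p ∈ (Finset.univ : Finset (Fin D)).offDiag, (v p.1 - v p.2) ^ 2 =
      D * ∑ i, v i ^ 2 - (∑ i, v i) ^ 2 := by
  have h1 : ∑ p ∈ (Finset.univ : Finset (Fin D)).offDiag, (v p.1 - v p.2) ^ 2 =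
      ∑ i, ∑ j, (v i - v j) ^ 2 := by
    rw [← Finset.sum_product', ← Finset.diag_union_offDiag,
      Finset.sum_union (Finset.disjoint_diag_offDiag _)]
    simp [Finset.sum_diag]
  have h2 : ∀ i j, (v i - v j) ^ 2 = v i ^ 2 + v j ^ 2 - 2 * (v i * v j) := fun i j => by ring
  rw [h1]
  simp only [h2, Finset.sum_sub_distrib, Finset.sum_add_distrib, ← Finset.mul_sum,
    ← Finset.sum_mul, Finset.sum_const, Finset.card_univ, Fintype.card_fin, nsmul_eq_mul]
  ring

/-- A model built from a diverse feature map satisfies `G(x)² ≤ 𝒥`. -/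
lemma innerModel_sq_le_diversityFactor {α : Type*} {D : ℕ} {F : Set (α → ℝ)} {A ϑ β : ℝ}
    {w : Fin D → ℝ} (hw : ‖w‖ ≤ β) {Φ : α → EuclideanSpace ℝ (Fin D)}
    (hΦ : Φ ∈ admissibleFeatures D F A) (hdiv : IsDiverse ϑ Φ) (x : α) :
    innerModel w Φ x ^ 2 ≤ diversityFactor β D A ϑ := by
  obtain ⟨-, hnn, hA⟩ := hΦ
  have hβ : 0 ≤ β := (norm_nonneg _).trans hw
  have h1 := hdiv x
  rw [half_sum_offDiag_sub_sq (fun i => Φ x i)] at h1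
  have h2 : ∑ i, Φ x i ^ 2 ≤ A ^ 2 := by
    rw [← EuclideanSpace.real_norm_sq_eq]
    exact pow_le_pow_left₀ (norm_nonneg _) (hA x) 2
  have h3 : |innerModel w Φ x| ≤ β * ∑ i, Φ x i := by
    rw [Finset.mul_sum]
    refine (Finset.abs_sum_le_sum_abs _ _).trans (Finset.sum_le_sum fun i _ => ?_)
    rw [abs_mul, abs_of_nonneg (hnn x i)]
    exact mul_le_mul_of_nonneg_right ((norm_le_pi_norm w i).trans hw) (hnn x i)
  have h4 := pow_le_pow_left₀ (abs_nonneg _) h3 2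
  rw [sq_abs, mul_pow] at h4
  refine h4.trans (mul_le_mul_of_nonneg_left ?_ (sq_nonneg β))
  have := mul_le_mul_of_nonneg_left h2 (Nat.cast_nonneg' (α := ℝ) D)
  linarith

lemma exists_countable_sequentially_dense {E : Type*} [PseudoMetricSpace E]
    [SecondCountableTopology E] (W : Set E) :
    ∃ W₀ ⊆ W, W₀.Countable ∧ ∀ w ∈ W, ∃ v : ℕ → E, (∀ n, v n ∈ W₀) ∧
      Tendsto v atTop (𝓝 w) := by
  obtain ⟨s, hs, hd⟩ := TopologicalSpace.exists_countable_dense W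
  refine ⟨Subtype.val '' s, by simp, hs.image _, fun w hw => ?_⟩
  obtain ⟨v, hv, hlim⟩ := mem_closure_iff_seq_limit.mp (hd ⟨w, hw⟩)
  exact ⟨fun n => v n, fun n => ⟨_, hv n, rfl⟩, (continuous_subtype_val.tendsto _).comp hlim⟩

/-- Only membership in `F` is used: the approximating features may violate non-negativity, the norm
bound and diversity. -/
lemma exists_tendsto_sum_mul {α : Type*} {D : ℕ} {F F₀ : Set (α → ℝ)} {A : ℝ}
    {W₀ : Set (Fin D → ℝ)}
    (hd : ∀ f ∈ F, ∃ u : ℕ → α → ℝ, (∀ n, u n ∈ F₀) ∧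
      ∀ x, Tendsto (fun n => u n x) atTop (𝓝 (f x)))
    {w : Fin D → ℝ} (hw : ∃ v : ℕ → Fin D → ℝ, (∀ n, v n ∈ W₀) ∧ Tendsto v atTop (𝓝 w))
    {Φ : α → EuclideanSpace ℝ (Fin D)} (hΦ : Φ ∈ admissibleFeatures D F A) :
    ∃ (v : ℕ → W₀) (u : ℕ → Fin D → F₀), ∀ x,
      Tendsto (fun n => ∑ d, (v n : Fin D → ℝ) d * (u n d : α → ℝ) x) atTop
        (𝓝 (innerModel w Φ x)) := by
  obtain ⟨v, hv, hvl⟩ := hw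
  choose u hu hul using fun d => hd _ (hΦ.1 d)
  refine ⟨fun n => ⟨v n, hv n⟩, fun n d => ⟨u d n, hu d n⟩, fun x => ?_⟩
  exact tendsto_finsetSum _ fun d _ => ((tendsto_pi_nhds.mp hvl d)).mul (hul d x)

lemma tendsto_generalizationGap {Z : Type*} [MeasurableSpace Z] (μ : Measure Z)
    [IsProbabilityMeasure μ] {m : ℕ} (S : Fin m → Z) {E : ℕ → Z → ℝ} {E' : Z → ℝ}
    (hm : ∀ n, Measurable (E n)) {C : ℝ} (hC : ∀ n z, |E n z| ≤ C)
    (hlim : ∀ z, Tendsto (fun n => E n z) atTop (𝓝 (E' z))) :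
    Tendsto (fun n => generalizationGap μ S (E n)) atTop (𝓝 (generalizationGap μ S E')) := by
  refine Tendsto.sub ?_ ((tendsto_finsetSum _ fun j _ => hlim (S j)).const_mul _)
  exact tendsto_integral_of_dominated_convergence (fun _ => C)
    (fun n => (hm n).aestronglyMeasurable) (integrable_const _)
    (fun n => ae_of_all _ (hC n)) (ae_of_all _ hlim)

/-- The uniform bound for the class of all models with diverse admissible feature maps. -/
lemma withProbAtLeast_forall_diverse {X Y : Type*} [MeasurableSpace X] [MeasurableSpace Y]
    (μ : Measure (X × Y)) [IsProbabilityMeasure μ] {m : ℕ} (hm : 0 < m)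
    {D₁ D₂ : ℕ} {A₁ A₂ ϑ₁ ϑ₂ : ℝ}
    {F₁ : Set (X → ℝ)} (hF₁ : IsRegularClass F₁) {F₂ : Set (Y → ℝ)} (hF₂ : IsRegularClass F₂)
    {W₁ : Set (Fin D₁ → ℝ)} {β₁ : ℝ} (hβ₁ : ∀ w ∈ W₁, ‖w‖ ≤ β₁)
    {W₂ : Set (Fin D₂ → ℝ)} {β₂ : ℝ} (hβ₂ : ∀ w ∈ W₂, ‖w‖ ≤ β₂)
    (hW₁ : W₁.Subsingleton ∨ (0 : X → ℝ) ∈ F₁) (hW₂ : W₂.Subsingleton ∨ (0 : Y → ℝ) ∈ F₂)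
    {δ : ℝ} (hδ : δ ∈ Set.Ioo (0 : ℝ) 1) :
    WithProbAtLeast (Measure.pi fun _ : Fin m => μ) (1 - δ)
      {S | ∀ h₁ ∈ innerModels W₁ (admissibleFeatures D₁ F₁ A₁ ∩ {Φ | IsDiverse ϑ₁ Φ}),
        ∀ h₂ ∈ innerModels W₂ (admissibleFeatures D₂ F₂ A₂ ∩ {Φ | IsDiverse ϑ₂ Φ}),
          generalizationGap μ S (implicitEnergy h₁ h₂) ≤
            8 * (√(diversityFactor β₁ D₁ A₁ ϑ₁) + √(diversityFactor β₂ D₂ A₂ ϑ₂)) *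
                (D₁ * β₁ * rademacherComplexity μ m Prod.fst F₁ +
                  D₂ * β₂ * rademacherComplexity μ m Prod.snd F₂) +
              (diversityFactor β₁ D₁ A₁ ϑ₁ + diversityFactor β₂ D₂ A₂ ϑ₂) *
                √(Real.log (2 / δ) / (2 * m))} := by
  -- Without a model on either side the claim is vacuous. Otherwise an actual model shows `𝒥 ≥ 0`,
  -- which is needed for `a ^ 2` and `b ^ 2` to equal the diversity factors.
  rcases (innerModels W₁
    (admissibleFeatures D₁ F₁ A₁ ∩ {Φ | IsDiverse ϑ₁ Φ})).eq_empty_or_nonempty with h | hne₁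
  · refine ⟨Set.univ, MeasurableSet.univ, fun S _ => by simp [h], ?_⟩
    rw [measure_univ, ENNReal.ofReal_le_one]
    linarith [hδ.1]
  rcases (innerModels W₂
    (admissibleFeatures D₂ F₂ A₂ ∩ {Φ | IsDiverse ϑ₂ Φ})).eq_empty_or_nonempty with h | hne₂
  · refine ⟨Set.univ, MeasurableSet.univ, fun S _ => by simp [h], ?_⟩
    rw [measure_univ, ENNReal.ofReal_le_one]
    linarith [hδ.1]
  obtain ⟨-, w₁', hw₁', Φ₁', ⟨hΦ₁', hdiv₁'⟩, -⟩ := hne₁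
  obtain ⟨-, w₂', hw₂', Φ₂', ⟨hΦ₂', hdiv₂'⟩, -⟩ := hne₂
  obtain ⟨z₀⟩ : Nonempty (X × Y) := nonempty_of_isProbabilityMeasure μ
  have hJ₁ : 0 ≤ diversityFactor β₁ D₁ A₁ ϑ₁ := (sq_nonneg _).trans
    (innerModel_sq_le_diversityFactor (hβ₁ _ hw₁') hΦ₁' hdiv₁' z₀.1)
  have hJ₂ : 0 ≤ diversityFactor β₂ D₂ A₂ ϑ₂ := (sq_nonneg _).trans
    (innerModel_sq_le_diversityFactor (hβ₂ _ hw₂') hΦ₂' hdiv₂' z₀.2)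
  obtain ⟨F₁₀, hsub₁, hcount₁, hd₁⟩ := hF₁.separable
  obtain ⟨F₂₀, hsub₂, hcount₂, hd₂⟩ := hF₂.separable
  obtain ⟨W₁₀, hWsub₁, hWcount₁, hWd₁⟩ := exists_countable_sequentially_dense W₁
  obtain ⟨W₂₀, hWsub₂, hWcount₂, hWd₂⟩ := exists_countable_sequentially_dense W₂
  have := hcount₁.to_subtype
  have := hcount₂.to_subtype
  have := hWcount₁.to_subtype
  have := hWcount₂.to_subtype
  set a := √(diversityFactor β₁ D₁ A₁ ϑ₁) with ha
  set b := √(diversityFactor β₂ D₂ A₂ ϑ₂) with hb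
  set B := 8 * (a + b) * (D₁ * β₁ * rademacherComplexity μ m Prod.fst F₁ +
      D₂ * β₂ * rademacherComplexity μ m Prod.snd F₂) +
    (diversityFactor β₁ D₁ A₁ ϑ₁ + diversityFactor β₂ D₂ A₂ ϑ₂) *
      √(Real.log (2 / δ) / (2 * m)) with hB
  let ι := (W₁₀ × (Fin D₁ → F₁₀)) × (W₂₀ × (Fin D₂ → F₂₀))
  let E : ι → X × Y → ℝ := fun i => truncatedEnergy a b i.1.1 (fun d => i.1.2 d) i.2.1
    (fun d => i.2.2 d)
  have hEm : ∀ i, Measurable (E i) := fun i =>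
    measurable_truncatedEnergy a b _ (fun d => hF₁.measurable _ (hsub₁ (i.1.2 d).2)) _
      fun d => hF₂.measurable _ (hsub₂ (i.2.2 d).2)
  have hEC : ∀ i z, |E i z| ≤ a ^ 2 + b ^ 2 := fun i z => by
    rw [abs_of_nonneg (truncatedEnergy_nonneg _ _ _ _ _ _ _)]
    exact truncatedEnergy_le (Real.sqrt_nonneg _) (Real.sqrt_nonneg _) _ _ _ _ _
  have : Nonempty ι := by
    obtain ⟨v₁, u₁, -⟩ := exists_tendsto_sum_mul hd₁ (hWd₁ _ hw₁') hΦ₁'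
    obtain ⟨v₂, u₂, -⟩ := exists_tendsto_sum_mul hd₂ (hWd₂ _ hw₂') hΦ₂'
    exact ⟨(v₁ 0, u₁ 0), (v₂ 0, u₂ 0)⟩
  have hbad : (Measure.pi fun _ : Fin m => μ) (⋃ i, {S | B < generalizationGap μ S (E i)}) ≤
      ENNReal.ofReal δ := by
    refine measure_iUnion_le_of_forall_finite _ _ fun n e => ?_
    have := measure_iUnion_generalizationGap_gt_le μ hm (a := a) (b := b) (Real.sqrt_nonneg _)
      (Real.sqrt_nonneg _) hF₁ hF₂ (fun k => (e k).1.1) (β₁ := β₁)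
      (fun k => hβ₁ _ (hWsub₁ (e k).1.1.2)) (fun k => (e k).2.1) (β₂ := β₂)
      (fun k => hβ₂ _ (hWsub₂ (e k).2.1.2)) (fun k d => (e k).1.2 d)
      (fun k d => hsub₁ ((e k).1.2 d).2) (fun k d => (e k).2.2 d)
      (fun k d => hsub₂ ((e k).2.2 d).2)
      (hW₁.imp_left fun h k k' => h (hWsub₁ (e k).1.1.2) (hWsub₁ (e k').1.1.2))
      (hW₂.imp_left fun h k k' => h (hWsub₂ (e k).2.1.2) (hWsub₂ (e k').2.1.2)) hδ
    rwa [ha, hb, Real.sq_sqrt hJ₁, Real.sq_sqrt hJ₂, ← ha, ← hb, ← hB] at this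
  have hmeas : MeasurableSet (⋃ i, {S : Fin m → X × Y | B < generalizationGap μ S (E i)}) := by
    refine MeasurableSet.iUnion fun i => measurableSet_lt measurable_const ?_
    unfold generalizationGap
    have := hEm i
    fun_prop
  refine ⟨_, hmeas.compl, ?_, ?_⟩
  · rintro S hS _ ⟨w₁, hw₁, Φ₁, ⟨hΦ₁, hdiv₁⟩, rfl⟩ _ ⟨w₂, hw₂, Φ₂, ⟨hΦ₂, hdiv₂⟩, rfl⟩
    simp only [Set.mem_compl_iff, Set.mem_iUnion, Set.mem_ofPred_eq, not_exists, not_lt] at hS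
    obtain ⟨v₁, u₁, hl₁⟩ := exists_tendsto_sum_mul hd₁ (hWd₁ _ hw₁) hΦ₁
    obtain ⟨v₂, u₂, hl₂⟩ := exists_tendsto_sum_mul hd₂ (hWd₂ _ hw₂) hΦ₂
    have hlim : ∀ z, Tendsto (fun n => E ((v₁ n, u₁ n), (v₂ n, u₂ n)) z) atTop
        (𝓝 (implicitEnergy (innerModel w₁ Φ₁) (innerModel w₂ Φ₂) z)) := by
      intro z
      have t₁ := ((continuous_truncate a).tendsto _).comp (hl₁ z.1)
      have t₂ := ((continuous_truncate b).tendsto _).comp (hl₂ z.2)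
      -- The limit model is diverse, so it lies within the truncation level.
      rw [truncate_of_abs_le (Real.abs_le_sqrt
        (innerModel_sq_le_diversityFactor (hβ₁ _ hw₁) hΦ₁ hdiv₁ z.1))] at t₁
      rw [truncate_of_abs_le (Real.abs_le_sqrt
        (innerModel_sq_le_diversityFactor (hβ₂ _ hw₂) hΦ₂ hdiv₂ z.2))] at t₂
      exact ((t₁.sub t₂).norm.pow 2).const_mul _
    exact le_of_tendsto (tendsto_generalizationGap μ S (fun n => hEm _) (fun n => hEC _) hlim)
      (Eventually.of_forall fun n => hS _)
  · rw [prob_compl_eq_one_sub hmeas, ENNReal.ofReal_sub _ hδ.1.le, ENNReal.ofReal_one]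
    exact tsub_le_tsub_left hbad 1

/-! ### Random collections of feature maps. -/

lemma innerModels_mono {α : Type*} {D : ℕ} (W : Set (Fin D → ℝ))
    {G G' : Set (α → EuclideanSpace ℝ (Fin D))} (h : G ⊆ G') : innerModels W G ⊆ innerModels W G' :=
  fun _ ⟨w, hw, Φ, hΦ, he⟩ => ⟨w, hw, Φ, h hΦ, he⟩

end

theorem theorem4
    {X Y : Type*} [MeasurableSpace X] [MeasurableSpace Y]
    (μ : Measure (X × Y)) [IsProbabilityMeasure μ]
    (m : ℕ) (hm : 0 < m)
    (D₁ D₂ : ℕ) (A₁ A₂ ϑ₁ ϑ₂ : ℝ)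
    -- the two classes of feature functions
    (F₁ : Set (X → ℝ)) (hF₁ : IsRegularClass F₁)
    (F₂ : Set (Y → ℝ)) (hF₂ : IsRegularClass F₂)
    -- the weight vectors, with sup norm at most `β₁` and `β₂`
    (W₁ : Set (Fin D₁ → ℝ)) (β₁ : ℝ) (hβ₁ : ∀ w ∈ W₁, ‖w‖ ≤ β₁)
    (W₂ : Set (Fin D₂ → ℝ)) (β₂ : ℝ) (hβ₂ : ∀ w ∈ W₂, ‖w‖ ≤ β₂)
    -- for each model, the weights are fixed or the zero function is a feature function
    (hW₁ : W₁.Subsingleton ∨ (0 : X → ℝ) ∈ F₁)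
    (hW₂ : W₂.Subsingleton ∨ (0 : Y → ℝ) ∈ F₂)
    -- the random collections of feature maps
    {Ω₁ Ω₂ : Type*} [MeasurableSpace Ω₁] [MeasurableSpace Ω₂]
    (P₁ : Measure Ω₁) [IsProbabilityMeasure P₁]
    (P₂ : Measure Ω₂) [IsProbabilityMeasure P₂]
    (G₁ : Ω₁ → Set (X → EuclideanSpace ℝ (Fin D₁)))
    (hG₁ : ∀ ω, G₁ ω ⊆ admissibleFeatures D₁ F₁ A₁)
    (G₂ : Ω₂ → Set (Y → EuclideanSpace ℝ (Fin D₂)))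
    (hG₂ : ∀ ω, G₂ ω ⊆ admissibleFeatures D₂ F₂ A₂)
    -- diversity with probabilities `τ₁` and `τ₂`
    (τ₁ τ₂ : ℝ) (hτ₁ : τ₁ ∈ Set.Icc (0 : ℝ) 1) (hτ₂ : τ₂ ∈ Set.Icc (0 : ℝ) 1)
    (hdiv₁ : WithProbAtLeast P₁ τ₁ {ω | ∀ Φ ∈ G₁ ω, IsDiverse ϑ₁ Φ})
    (hdiv₂ : WithProbAtLeast P₂ τ₂ {ω | ∀ Φ ∈ G₂ ω, IsDiverse ϑ₂ Φ})
    (δ : ℝ) (hδ : δ ∈ Set.Ioo (0 : ℝ) 1) :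
    WithProbAtLeast (P₁.prod (P₂.prod (Measure.pi fun _ : Fin m => μ)))
      ((1 - δ) * τ₁ * τ₂)
      {q : Ω₁ × Ω₂ × (Fin m → X × Y) |
        ∀ h₁ ∈ innerModels W₁ (G₁ q.1), ∀ h₂ ∈ innerModels W₂ (G₂ q.2.1),
          generalizationGap μ q.2.2 (implicitEnergy h₁ h₂) ≤
            8 * (√(diversityFactor β₁ D₁ A₁ ϑ₁) + √(diversityFactor β₂ D₂ A₂ ϑ₂)) *
                (D₁ * β₁ * rademacherComplexity μ m Prod.fst F₁ +
                  D₂ * β₂ * rademacherComplexity μ m Prod.snd F₂) +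
              (diversityFactor β₁ D₁ A₁ ϑ₁ + diversityFactor β₂ D₂ A₂ ϑ₂) *
                √(Real.log (2 / δ) / (2 * m))} := by
  obtain ⟨T₁, hT₁m, hT₁, hT₁p⟩ := hdiv₁
  obtain ⟨T₂, hT₂m, hT₂, hT₂p⟩ := hdiv₂
  obtain ⟨T, hTm, hT, hTp⟩ := withProbAtLeast_forall_diverse (A₁ := A₁) (A₂ := A₂) (ϑ₁ := ϑ₁)
    (ϑ₂ := ϑ₂) μ hm hF₁ hF₂ hβ₁ hβ₂ hW₁ hW₂ hδ
  -- Independence enters as the product measure: each factor of this rectangle constrains its own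
  -- coordinate.
  refine ⟨T₁ ×ˢ (T₂ ×ˢ T), hT₁m.prod (hT₂m.prod hTm), ?_, ?_⟩
  · rintro ⟨ω₁, ω₂, S⟩ ⟨h1, h2, h3⟩ h₁ hh₁ h₂ hh₂
    have hG₁' : G₁ ω₁ ⊆ admissibleFeatures D₁ F₁ A₁ ∩ {Φ | IsDiverse ϑ₁ Φ} :=
      fun Φ hΦ => ⟨hG₁ _ hΦ, hT₁ h1 Φ hΦ⟩
    have hG₂' : G₂ ω₂ ⊆ admissibleFeatures D₂ F₂ A₂ ∩ {Φ | IsDiverse ϑ₂ Φ} :=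
      fun Φ hΦ => ⟨hG₂ _ hΦ, hT₂ h2 Φ hΦ⟩
    exact hT h3 h₁ (innerModels_mono W₁ hG₁' hh₁) h₂ (innerModels_mono W₂ hG₂' hh₂)
  · rw [Measure.prod_prod, Measure.prod_prod,
      show (1 - δ) * τ₁ * τ₂ = τ₁ * (τ₂ * (1 - δ)) by ring,
      ENNReal.ofReal_mul hτ₁.1, ENNReal.ofReal_mul hτ₂.1]
    gcongr
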